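/- **Graphs.** A BM graph is a pair of finite sets $V$ (vertices), $F$ (flags) with a map $\partial:F\to V$ and an involution $j:F\to F$; the fixpoints of $j$ are called tails, their set is $T$; the two-element orbits of $j$ are the edges. A morphism $h:\tau\to\sigma$ of BM graphs is a triple $(h^F,h_V,j_h)$, with $h^F:F_\sigma\to F_\tau$ injective, $h_V:V_\tau\to V_\sigma$ surjective and $j_h$ a fixpoint-free involution of $F_\tau\setminus h^F(F_\sigma)$, such that: $h^F(F_\sigma)$ is $j_\tau$-invariant; $j_h$ agrees with $j_\tau$ on edges; $h_V(\partial_\tau h^F(f))=\partial_\sigma f$ for $f\in F_\sigma$; $h_V(\partial_\tau f)=h_V(\partial_\tau j_h f)$ for $f\notin h^F(F_\sigma)$; and $(h^F)^{-1}$ maps edges of $\tau$ contained in $h^F(F_\sigma)$ to edges of $\sigma$. The composite $c\circ g$ has $h_V=c_V\circ g_V$, $h^F=g^F\circ c^F$, and $j_h$ is $j_g$ on the complement of $g^F$ and $j_c$ on the complement of $c^F$. This is the category $\mathbf{BM}$. A *compression* is a morphism $h:\tau\to\sigma$ for which $h^F$ restricts to a bijection $T_\sigma\to T_\tau$; $\mathbf{BM}_{\rm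 comp}\subset\mathbf{BM}$ is the wide subcategory of compressions. A JK graph is a diagram of finite sets $A\xleftarrow{s}H\xrightarrow{p}V$ with $s$ injective, together with a fixpoint-free involution $i$ of $A$. An etale morphism is a triple of maps commuting with $i,s,p$ such that the square of the maps $p$ is a pullback; this gives the category $\mathbf{Gr}$. A port is an arc $a\in A$ not in the image of $s$; an edge $\{a,i(a)\}$ is isolated if both $a$ and $i(a)$ are ports; a graph is effective if it is nonempty and has no isolated edges. The elementary graphs are the unit graph $\mathsf I$ (one edge, no vertices) and, for every finite set $n$, the corolla $\mathsf n$ (one vertex, $H=n$, $A=n+n$, with $i$ interchanging the two copies of $n$ and $s$ the inclusion of one of them, so that the other one is the set of ports); $\mathbf{elGr}\subset\mathbf{Gr}$ is the full subcategory of elementary graphs. A graphical species is a presheaf on $\mathbf{elGr}$; graphs embed fully faithfully into species by $\mathsf X\mapsto\operatorname{Hom}_{\mathbf{Gr}}(-,\mathsf X)$, and for a species $F$ and a graph $\mathsf G$ one puts $F[\mathsf G]=\operatorname{Hom}(\mathsf G,F)$. **Monad.** For a finite set $n$, an effective $\mathsf n$-graph is an effective graph with a bijection between its set of ports and $n$.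 The monad $F\mapsto\overline F$ on graphical species has $\overline F[\mathsf I]=F[\mathsf I]$, and $\overline F[\mathsf n]$ is the set of isomorphism classes (isomorphisms fixing the ports and respecting decorations) of effective $\mathsf n$-graphs $\mathsf G$ decorated by an element of $F[\mathsf G]$. The unit regards an operation as a decorated corolla. The multiplication takes a graph $\mathsf G$ each of whose vertices $v$ is decorated by an $F$-decorated graph $\mathsf G_v$ with the same interface as $v$ to the colimit obtained by gluing the $\mathsf G_v$ in the same way as $\mathsf G$ is glued from its corollas. **Restricted Kleisli category.** $\widetilde{\mathbf{Gr}}$ is the full subcategory of the Kleisli category of this monad on the graphs without isolated edges; a morphism $\mathsf R\to\mathsf Y$ is thus a morphism of species $\mathsf R\to\overline{\mathsf Y}$. It assigns to each vertex $x$ of $\mathsf R$ an effective graph $\mathsf S_x\to\mathsf Y$ etale over $\mathsf Y$, with the same interface as $x$. Gluing the $\mathsf S_x$ in the way in which $\mathsf R$ is glued from its corollas gives a colimit graph $\mathsf S$ with an etale morphism $\mathsf S\to\mathsf Y$; the Kleisli morphism is *generic* (a *refinement*) if $\mathsf S\to\mathsf Y$ is invertible. Generic morphisms form a wide subcategory $\widetilde{\mathbf{Gr}}_{\rm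 gen}\subset\widetilde{\mathbf{Gr}}$. **Statement.** There is a canonical equivalence of categories $$\Phi_2:\mathbf{BM}_{\rm comp}\;\simeq\;\widetilde{\mathbf{Gr}}{}_{\rm gen}^{\rm op}.$$ On objects it sends $(V,F,\partial,j)$ to the graph without isolated edges with vertex set $V$, $H=F$, $p=\partial$, $A=F+T$, $s$ the inclusion of $F$, and involution $i$ given by $j$ on the flags that are not tails and interchanging each tail with its copy in $T$. It sends a compression $h:\sigma\to\rho$ to a generic morphism $\mathsf R\to\mathsf S$ between the graphs $\mathsf R,\mathsf S$ associated with $\rho,\sigma$, which sends the arc of each flag $f\in F_\rho$ to the arc of the flag $h^F(f)$, and for which the vertices of $\mathsf S$ in the image of the graph $\mathsf S_x\to\mathsf S$ assigned to a vertex $x$ of $\mathsf R$ are exactly those in $h_V^{-1}(x)$. -/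

import Mathlib

open CategoryTheory

noncomputable section

/-- A graph in the sense of Joyal and Kock: finite sets `A` of arcs, `H` of half-edges (flags),
`V` of vertices, a fixpoint-free involution `i` on `A`, an injection `s : H → A` and a map
`p : H → V`. -/
structure Gr where
  A : Type
  H : Type
  V : Type
  finA : Finite A
  finH : Finite H
  finV : Finite V
  i : A → A
  s : H → A
  p : H → V
  i_i : ∀ a, i (i a) = a
  i_ne : ∀ a, i a ≠ a
  s_inj : Function.Injective s

namespace Gr

/-- An etale morphism of graphs: the square of `p`'s is a pullback. -/
@[ext]
structure Hom (X Y : Gr) where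
  a : X.A → Y.A
  h : X.H → Y.H
  v : X.V → Y.V
  a_i : ∀ x, a (X.i x) = Y.i (a x)
  a_s : ∀ x, a (X.s x) = Y.s (h x)
  v_p : ∀ x, v (X.p x) = Y.p (h x)
  cart : ∀ (w : X.V) (k : Y.H), Y.p k = v w → ∃! x : X.H, X.p x = w ∧ h x = k

instance : Category Gr where
  Hom := Hom
  id X :=
    { a := id, h := id, v := id, a_i := fun _ => rfl, a_s := fun _ => rfl, v_p := fun _ => rfl
      cart := fun w k hk => ⟨k, ⟨hk, rfl⟩, fun _ hy => hy.2⟩ }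
  comp {X Y Z} f g :=
    { a := g.a ∘ f.a, h := g.h ∘ f.h, v := g.v ∘ f.v
      a_i := fun x => by simp [f.a_i, g.a_i]
      a_s := fun x => by simp [f.a_s, g.a_s]
      v_p := fun x => by simp [f.v_p, g.v_p]
      cart := fun w k hk => by
        obtain ⟨y, ⟨hy1, hy2⟩, hy3⟩ := g.cart (f.v w) k hk
        obtain ⟨x, ⟨hx1, hx2⟩, hx3⟩ := f.cart w y hy1
        refine ⟨x, ⟨hx1, by simp [hx2, hy2]⟩, fun x' hx' => hx3 x' ⟨hx'.1, hy3 _ ⟨?_, hx'.2⟩⟩⟩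
        rw [← f.v_p, hx'.1] }

@[simp] lemma id_a (X : Gr) (x : X.A) : Hom.a (𝟙 X) x = x := rfl
@[simp] lemma id_h (X : Gr) (x : X.H) : Hom.h (𝟙 X) x = x := rfl
@[simp] lemma id_v (X : Gr) (x : X.V) : Hom.v (𝟙 X) x = x := rfl
@[simp] lemma comp_a {X Y Z : Gr} (f : X ⟶ Y) (g : Y ⟶ Z) (x : X.A) :
    (f ≫ g).a x = g.a (f.a x) := rfl
@[simp] lemma comp_h {X Y Z : Gr} (f : X ⟶ Y) (g : Y ⟶ Z) (x : X.H) :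
    (f ≫ g).h x = g.h (f.h x) := rfl
@[simp] lemma comp_v {X Y Z : Gr} (f : X ⟶ Y) (g : Y ⟶ Z) (x : X.V) :
    (f ≫ g).v x = g.v (f.v x) := rfl

lemma hom_ext {X Y : Gr} {f g : X ⟶ Y} (ha : ∀ x, f.a x = g.a x) (hh : ∀ x, f.h x = g.h x)
    (hv : ∀ x, f.v x = g.v x) : f = g :=
  Hom.ext (funext ha) (funext hh) (funext hv)

/-- A port is an arc which is not in the image of `s`. -/
def IsPort (X : Gr) (a : X.A) : Prop := a ∉ Set.range X.s

/-- An edge `{a, i a}` is isolated if both of its arcs are ports. -/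
def NoIsolatedEdges (X : Gr) : Prop := ∀ a, ¬ (X.IsPort a ∧ X.IsPort (X.i a))

/-- A graph is effective if it is nonempty and has no isolated edges. -/
def Effective (X : Gr) : Prop := (Nonempty X.A ∨ Nonempty X.V) ∧ X.NoIsolatedEdges

/-- The unit graph: one edge, no vertices. -/
abbrev unit : Gr where
  A := Bool
  H := Empty
  V := Empty
  finA := inferInstance
  finH := inferInstance
  finV := inferInstance
  i := not
  s := Empty.elim
  p := Empty.elim
  i_i := by simp
  i_ne := by simp
  s_inj := fun x => x.elim

/-- The corolla with set of ports `n`. -/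
abbrev corolla (n : Type) (hn : Finite n) : Gr where
  A := n ⊕ n
  H := n
  V := Unit
  finA := inferInstance
  finH := hn
  finV := inferInstance
  i := Sum.swap
  s := Sum.inr
  p := fun _ => ()
  i_i := by simp
  i_ne := by rintro (a | a) <;> simp
  s_inj := Sum.inr_injective

end Gr

/-- The elementary graphs, that is, up to isomorphism, the connected graphs without inner edges:
the unit graph and the corollas, one for each finite set of ports. -/
inductive El : Type 1
  | unit : El
  | cor (n : Type) (hn : Finite n) : El

/-- The elementary graphs as graphs. -/
abbrev El.gr : El → Gr
  | .unit => Gr.unit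
  | .cor n hn => Gr.corolla n hn

/-- The category of elementary graphs is the full subcategory of the category of graphs and
etale morphisms. -/
instance : Category El where
  Hom E E' := E.gr ⟶ E'.gr
  id E := 𝟙 E.gr
  comp {E E' E''} f g := (show E.gr ⟶ E''.gr from
    (show E.gr ⟶ E'.gr from f) ≫ (show E'.gr ⟶ E''.gr from g))
  id_comp {E E'} f := Category.id_comp (show E.gr ⟶ E'.gr from f)
  comp_id {E E'} f := Category.comp_id (show E.gr ⟶ E'.gr from f)
  assoc {E E' E'' E'''} f g h := Category.assoc (show E.gr ⟶ E'.gr from f)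
    (show E'.gr ⟶ E''.gr from g) (show E''.gr ⟶ E'''.gr from h)

/-- Graphical species: presheaves on the category of elementary graphs. The values are in `Type 1`,
so that sets of isomorphism classes of (small) decorated graphs are allowed as values. -/
abbrev Species := Elᵒᵖ ⥤ Type 1

/-- Restriction of elements of a species along a morphism of elementary graphs. -/
abbrev Species.res (F : Species) {E E' : El} (u : E' ⟶ E) (x : F.obj (.op E)) : F.obj (.op E') :=
  F.map u.op x

/-- The embedding of graphs into graphical species, `X ↦ Hom(-, X)`. -/
def yo : Gr ⥤ Species where
  obj X :=
    { obj := fun E => ULift (E.unop.gr ⟶ X)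
      map := fun u => TypeCat.ofHom fun x => ⟨Quiver.Hom.unop u ≫ x.down⟩ }
  map f := { app := fun E => TypeCat.ofHom fun x => ⟨x.down ≫ f⟩ }

/-- A morphism of species `γ : X ⟶ F`, with `X` a graph, evaluated at an element `u` of `X`. -/
def ev {X : Gr} {F : Species} (γ : yo.obj X ⟶ F) {E : El} (u : E.gr ⟶ X) : F.obj (.op E) :=
  γ.app (.op E) ⟨u⟩

lemma res_id (F : Species) {E : El} (x : F.obj (.op E)) : F.res (𝟙 E) x = x := by
  simp [Species.res]

lemma res_res (F : Species) {E E' E'' : El} (u : E' ⟶ E) (w : E'' ⟶ E') (x : F.obj (.op E)) :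
    F.res w (F.res u x) = F.res (w ≫ u) x := by
  simp [Species.res]

lemma app_res {F G : Species} (θ : F ⟶ G) {E E' : El} (u : E' ⟶ E) (x : F.obj (.op E)) :
    θ.app _ (F.res u x) = G.res u (θ.app _ x) :=
  ConcreteCategory.congr_hom (θ.naturality u.op) x

lemma res_ev {X : Gr} {F : Species} (γ : yo.obj X ⟶ F) {E E' : El} (w : E' ⟶ E) (u : E.gr ⟶ X) :
    F.res w (ev γ u) = ev γ ((show E'.gr ⟶ E.gr from w) ≫ u) :=
  (app_res γ w ⟨u⟩).symm

lemma ev_comp {X : Gr} {F G : Species} (γ : yo.obj X ⟶ F) (θ : F ⟶ G) {E : El} (u : E.gr ⟶ X) :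
    ev (γ ≫ θ) u = θ.app _ (ev γ u) := rfl

lemma ev_yo {X Y : Gr} {F : Species} (f : X ⟶ Y) (γ : yo.obj Y ⟶ F) {E : El} (u : E.gr ⟶ X) :
    ev (yo.map f ≫ γ) u = ev γ (u ≫ f) := rfl

lemma ev_ext {X : Gr} {F : Species} {γ γ' : yo.obj X ⟶ F}
    (h : ∀ (E : El) (u : E.gr ⟶ X), ev γ u = ev γ' u) : γ = γ' := by
  ext E x
  exact h E.unop x.down

namespace Gr

/-- The morphism from the unit graph picking out an arc. -/
def arc (X : Gr) (a : X.A) : El.unit.gr ⟶ X where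
  a := fun b => Bool.rec (X.i a) a b
  h := fun x => Empty.elim x
  v := fun x => Empty.elim x
  a_i := by rintro (_ | _) <;> simp [El.gr, unit, X.i_i]
  a_s := fun x => Empty.elim x
  v_p := fun x => Empty.elim x
  cart := fun x => Empty.elim x

@[simp] lemma arc_true (X : Gr) (a : X.A) : (X.arc a).a true = a := rfl

lemma unit_hom_ext {X : Gr} {u u' : El.unit.gr ⟶ X} (h : u.a true = u'.a true) : u = u' := by
  refine hom_ext ?_ (fun x => Empty.elim x) (fun x => Empty.elim x)
  rintro (_ | _)
  · exact (u.a_i true).trans ((congrArg X.i h).trans (u'.a_i true).symm)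
  · exact h

lemma eq_arc {X : Gr} (u : El.unit.gr ⟶ X) : u = X.arc (u.a true) := unit_hom_ext rfl

lemma arc_comp {X Y : Gr} (a : X.A) (f : X ⟶ Y) : X.arc a ≫ f = Y.arc (f.a a) := unit_hom_ext rfl

/-- The reversal of the unit graph. -/
def rev : El.unit ⟶ El.unit := El.unit.gr.arc false

lemma rev_comp_arc (X : Gr) (a : X.A) :
    (show El.unit.gr ⟶ El.unit.gr from rev) ≫ X.arc a = X.arc (X.i a) := unit_hom_ext rfl

/-- The set of flags at a vertex. -/
abbrev Fl (X : Gr) (w : X.V) : Type := {h : X.H // X.p h = w}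

lemma finite_fl (X : Gr) (w : X.V) : Finite (X.Fl w) :=
  have := X.finH
  inferInstance

/-- The corolla at a vertex, with its flags as set of ports. -/
abbrev elAt (X : Gr) (w : X.V) : El := .cor (X.Fl w) (X.finite_fl w)

/-- The canonical morphism from the corolla at `w`. -/
def corAt (X : Gr) (w : X.V) : (X.elAt w).gr ⟶ X where
  a := Sum.elim (fun h => X.i (X.s h.1)) (fun h => X.s h.1)
  h := fun h => h.1
  v := fun _ => w
  a_i := by rintro (a | a) <;> simp [X.i_i]
  a_s := fun x => rfl
  v_p := fun x => x.2.symm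
  cart := fun _ k hk => ⟨⟨k, hk⟩, ⟨rfl, rfl⟩, fun y hy => Subtype.ext hy.2⟩

lemma cor_hom_ext {n : Type} {hn : Finite n} {X : Gr} {u u' : (El.cor n hn).gr ⟶ X}
    (hv : u.v () = u'.v ()) (h : ∀ x, u.h x = u'.h x) : u = u' := by
  refine hom_ext ?_ h (fun _ => hv)
  have key : ∀ x : n, u.a (Sum.inr x) = u'.a (Sum.inr x) := fun x =>
    (u.a_s x).trans ((congrArg X.s (h x)).trans (u'.a_s x).symm)
  rintro (x | x)
  · exact (u.a_i (Sum.inr x)).trans ((congrArg X.i (key x)).trans (u'.a_i (Sum.inr x)).symm)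
  · exact key x

section lift

variable {X Y : Gr} (f : X ⟶ Y) {n : Type} {hn : Finite n} (u : (El.cor n hn).gr ⟶ Y) (w : X.V)

lemma lift_aux (hw : f.v w = u.v ()) (x : n) : ∃! k : X.H, X.p k = w ∧ f.h k = u.h x :=
  f.cart w (u.h x) ((u.v_p x).symm.trans hw.symm)

variable (hw : f.v w = u.v ())

/-- Lifting a morphism from a corolla along an etale morphism, given a lift of the vertex. -/
def lift : (El.cor n hn).gr ⟶ X where
  a := Sum.elim (fun x => X.i (X.s (lift_aux f u w hw x).choose))
    (fun x => X.s (lift_aux f u w hw x).choose)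
  h := fun x => (lift_aux f u w hw x).choose
  v := fun _ => w
  a_i := by rintro (a | a) <;> simp [X.i_i]
  a_s := fun x => rfl
  v_p := fun x => (lift_aux f u w hw x).choose_spec.1.1.symm
  cart := fun _ k hk => by
    obtain ⟨x, ⟨_, hx⟩, hx'⟩ := u.cart () (f.h k) (by rw [← f.v_p, hk, hw])
    refine ⟨x, ⟨rfl, ?_⟩, fun y hy => hx' y ⟨rfl, ?_⟩⟩
    · exact ((lift_aux f u w hw x).choose_spec.2 k ⟨hk, hx.symm⟩).symm
    · exact ((lift_aux f u w hw y).choose_spec.1.2).symm.trans (congrArg f.h hy.2)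

lemma lift_comp : lift f u w hw ≫ f = u :=
  cor_hom_ext hw fun x => (lift_aux f u w hw x).choose_spec.1.2

@[simp] lemma lift_v (x) : (lift f u w hw).v x = w := rfl

lemma lift_unique (u' : (El.cor n hn).gr ⟶ X) (h1 : u' ≫ f = u) (h2 : u'.v () = w) :
    u' = lift f u w hw :=
  cor_hom_ext h2 fun x => (lift_aux f u w hw x).choose_spec.2 _
    ⟨(u'.v_p x).symm.trans h2, by rw [← h1]; rfl⟩

end lift

/-- Every morphism from a corolla factors through the corolla at the image vertex. -/
def fac {X : Gr} {n : Type} {hn : Finite n} (u : (El.cor n hn).gr ⟶ X) :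
    El.cor n hn ⟶ X.elAt (u.v ()) :=
  lift (X.corAt (u.v ())) u () rfl

lemma fac_comp {X : Gr} {n : Type} {hn : Finite n} (u : (El.cor n hn).gr ⟶ X) :
    (show (El.cor n hn).gr ⟶ (X.elAt (u.v ())).gr from fac u) ≫ X.corAt (u.v ()) = u :=
  lift_comp _ _ _ _

lemma fac_unique {X : Gr} {n : Type} {hn : Finite n} (u : (El.cor n hn).gr ⟶ X)
    (r : (El.cor n hn).gr ⟶ (X.elAt (u.v ())).gr) (hr : r ≫ X.corAt (u.v ()) = u) : r = fac u :=
  lift_unique _ _ _ _ _ hr rfl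

/-- The morphism of elementary graphs picking out the outgoing arc of a flag of a corolla. -/
def out {n : Type} {hn : Finite n} (x : n) : El.unit ⟶ El.cor n hn :=
  (El.cor n hn).gr.arc (Sum.inr x)

lemma out_comp {X : Gr} {n : Type} {hn : Finite n} (u : (El.cor n hn).gr ⟶ X) (x : n) :
    (show El.unit.gr ⟶ (El.cor n hn).gr from out x) ≫ u = X.arc (X.s (u.h x)) :=
  unit_hom_ext (u.a_s x)

lemma rev_out {n : Type} {hn : Finite n} (x : n) :
    rev ≫ out (hn := hn) x = (El.cor n hn).gr.arc (Sum.inl x) :=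
  unit_hom_ext rfl

end Gr

open Gr

lemma dec_ext {X : Gr} {F : Species} {γ γ' : yo.obj X ⟶ F}
    (ha : ∀ a, ev γ (X.arc a) = ev γ' (X.arc a)) (hc : ∀ w, ev γ (X.corAt w) = ev γ' (X.corAt w)) :
    γ = γ' := by
  refine ev_ext fun E u => ?_
  cases E with
  | unit => rw [eq_arc u, ha]
  | cor n hn => rw [← fac_comp u, ← res_ev, ← res_ev, hc]

lemma ev_arc_i {X : Gr} {F : Species} (γ : yo.obj X ⟶ F) (a : X.A) :
    ev γ (X.arc (X.i a)) = F.res rev (ev γ (X.arc a)) := by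
  rw [res_ev, rev_comp_arc]

lemma ev_arc_s {X : Gr} {F : Species} (γ : yo.obj X ⟶ F) {w : X.V} (h : X.Fl w) :
    ev γ (X.arc (X.s h.1)) = F.res (out h) (ev γ (X.corAt w)) := by
  rw [res_ev]
  exact congrArg _ (unit_hom_ext rfl)

/-- The data of a morphism of species out of a graph. -/
structure DecData (X : Gr) (F : Species) where
  d : X.A → F.obj (.op .unit)
  c : ∀ w, F.obj (.op (X.elAt w))
  d_i : ∀ a, d (X.i a) = F.res rev (d a)
  d_s : ∀ w (h : X.Fl w), d (X.s h.1) = F.res (out h) (c w)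

/-- The value of a morphism of species built from `DecData`. -/
def DecData.val {X : Gr} {F : Species} (D : DecData X F) :
    ∀ (E : El), (E.gr ⟶ X) → F.obj (.op E)
  | .unit, u => D.d (u.a true)
  | .cor _ _, u => F.res (fac u) (D.c (u.v ()))

lemma DecData.val_nat {X : Gr} {F : Species} (D : DecData X F) {E E' : El} (w : E' ⟶ E)
    (u : E.gr ⟶ X) :
    D.val E' ((show E'.gr ⟶ E.gr from w) ≫ u) = F.res w (D.val E u) := by
  match E, E', w, u with
  | .unit, .cor _ _, w, u => exact Empty.elim (Gr.Hom.v w ())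
  | .unit, .unit, w, u =>
    have hw : w = El.unit.gr.arc (Gr.Hom.a w true) := eq_arc w
    cases hb : Gr.Hom.a w true with
    | true =>
      have : w = 𝟙 El.unit := unit_hom_ext hb
      subst this
      rw [res_id]; rfl
    | false =>
      have : w = rev := unit_hom_ext hb
      subst this
      exact (congrArg D.d (u.a_i true)).trans (D.d_i _)
  | .cor n hn, .cor m hm, w, u =>
    change F.res (fac _) (D.c _) = F.res w (F.res (fac u) (D.c _))
    rw [res_res]
    congr 2
    symm
    refine fac_unique ((show (El.cor m hm).gr ⟶ (El.cor n hn).gr from w) ≫ u) _ ?_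
    exact congrArg (fun t => (show (El.cor m hm).gr ⟶ (El.cor n hn).gr from w) ≫ t) (fac_comp u)
  | .cor n hn, .unit, w, u =>
    change D.d (u.a (Gr.Hom.a w true)) = F.res w (F.res (fac u) (D.c _))
    rw [res_res]
    have hs : ∀ x : n, D.d (u.a (Sum.inr x)) = F.res (out x ≫ fac u) (D.c (u.v ())) := by
      intro x
      have h1 : out x ≫ fac u = out (Gr.Hom.h (fac u) x) := out_comp _ _
      rw [h1]
      refine Eq.trans ?_ (D.d_s _ (Gr.Hom.h (fac u) x))
      congr 1
      refine (u.a_s x).trans (congrArg X.s ?_)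
      exact (congrArg (fun t => Gr.Hom.h t x) (fac_comp u)).symm
    have hw : w = (El.cor n hn).gr.arc (Gr.Hom.a w true) := eq_arc w
    generalize Gr.Hom.a w true = b at hw ⊢
    subst hw
    cases b with
    | inr x => exact hs x
    | inl x =>
      rw [← rev_out, Category.assoc, ← res_res, ← hs, ← D.d_i]
      exact congrArg D.d (u.a_i (Sum.inr x))

/-- The morphism of species built from `DecData`. -/
def DecData.hom {X : Gr} {F : Species} (D : DecData X F) : yo.obj X ⟶ F where
  app E := TypeCat.ofHom fun u => D.val E.unop u.down
  naturality E E' w := by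
    ext u
    exact D.val_nat w.unop u.down

lemma DecData.hom_arc {X : Gr} {F : Species} (D : DecData X F) (a : X.A) :
    ev D.hom (X.arc a) = D.d a := rfl

lemma DecData.hom_cor {X : Gr} {F : Species} (D : DecData X F) (w : X.V) :
    ev D.hom (X.corAt w) = D.c w := by
  have : fac (X.corAt w) = 𝟙 (X.elAt w) :=
    (fac_unique (X.corAt w) (𝟙 _) (Category.id_comp _)).symm
  change F.res (fac (X.corAt w)) (D.c w) = _
  rw [this]
  exact res_id F (D.c w)

/-- The etale morphism underlying a morphism of species between graphs. -/
def unyo {X Y : Gr} (θ : yo.obj X ⟶ yo.obj Y) : X ⟶ Y :=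
  have hk : ∀ (w : X.V) (k : X.Fl w), (ev θ (X.corAt (X.p k.1))).down.h ⟨k.1, rfl⟩ =
      (ev θ (X.corAt w)).down.h k := by rintro _ ⟨k, rfl⟩; rfl
  { a := fun a => (ev θ (X.arc a)).down.a true
    h := fun k => (ev θ (X.corAt (X.p k))).down.h ⟨k, rfl⟩
    v := fun w => (ev θ (X.corAt w)).down.v ()
    a_i := fun a => by
      rw [ev_arc_i]
      exact (ev θ (X.arc a)).down.a_i true
    a_s := fun k => by
      rw [ev_arc_s θ (⟨k, rfl⟩ : X.Fl (X.p k))]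
      exact (ev θ (X.corAt (X.p k))).down.a_s ⟨k, rfl⟩
    v_p := fun k => (ev θ (X.corAt (X.p k))).down.v_p ⟨k, rfl⟩
    cart := fun w k hkw => by
      obtain ⟨x, ⟨_, hx⟩, hx'⟩ := (ev θ (X.corAt w)).down.cart () k hkw
      refine ⟨x.1, ⟨x.2, (hk w x).trans hx⟩, fun y hy => ?_⟩
      let y' : X.Fl w := ⟨y, hy.1⟩
      have hy' : y' = x := hx' y' ⟨rfl, (hk w y').symm.trans hy.2⟩
      exact congrArg Subtype.val hy' }

lemma yo_unyo {X Y : Gr} (θ : yo.obj X ⟶ yo.obj Y) : yo.map (unyo θ) = θ := by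
  refine dec_ext (fun a => ?_) (fun w => ?_)
  · exact congrArg ULift.up (unit_hom_ext rfl)
  · refine congrArg ULift.up (cor_hom_ext rfl ?_)
    rintro ⟨k, rfl⟩
    rfl

lemma yo_injective {X Y : Gr} {f g : X ⟶ Y} (h : yo.map f = yo.map g) : f = g := by
  have ha : ∀ a, X.arc a ≫ f = X.arc a ≫ g := fun a =>
    congrArg ULift.down (congrArg (fun t => ev t (X.arc a)) h)
  have hc : ∀ w, X.corAt w ≫ f = X.corAt w ≫ g := fun w =>
    congrArg ULift.down (congrArg (fun t => ev t (X.corAt w)) h)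
  refine Gr.hom_ext (fun a => ?_) (fun k => ?_) (fun w => ?_)
  · exact congrArg (fun t => Gr.Hom.a t true) (ha a)
  · exact congrArg (fun t : (X.elAt (X.p k)).gr ⟶ Y => t.h ⟨k, rfl⟩) (hc (X.p k))
  · exact congrArg (fun t => Gr.Hom.v t ()) (hc w)

/-- For a finite set `n`, an effective `n`-graph is an effective graph with a bijection between
`n` and its set of ports. -/
structure NGraph (n : Type) where
  G : Gr
  eff : G.Effective
  β : n ≃ {a : G.A // G.IsPort a}

/-- The port with label `x`. -/
def NGraph.port {n : Type} (X : NGraph n) (x : n) : X.G.A := (X.β x).1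

/-- An effective `n`-graph decorated by a species `F`: an `n`-graph `G` with an element of
`F[G]`, that is, a morphism of species `G ⟶ F`. -/
structure DGraph (n : Type) (F : Species) extends NGraph n where
  γ : yo.obj G ⟶ F

/-- Let `G` be a graph, and for each vertex `v` let `K v` be a graph with some arcs `b v`
indexed by the flags at `v`. A cocone with vertex `F` consists of morphisms `K v ⟶ F` and an
involutive map from the arcs of `G` to `F`, sending the arc pointing towards `v` at a flag `h`
to the value at `b v h`. -/
structure Coc (G : Gr) (K : G.V → Gr) (b : ∀ v, G.Fl v → (K v).A) (F : Species) where
  γ : ∀ v, yo.obj (K v) ⟶ F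
  d : G.A → F.obj (.op .unit)
  d_i : ∀ x, d (G.i x) = F.res rev (d x)
  compat : ∀ v (h : G.Fl v), ev (γ v) ((K v).arc (b v h)) = d (G.i (G.s h.1))

/-- Composing a cocone with a morphism. -/
def Coc.push {G : Gr} {K : G.V → Gr} {b : ∀ v, G.Fl v → (K v).A} {F F' : Species}
    (c : Coc G K b F) (θ : F ⟶ F') : Coc G K b F' where
  γ v := c.γ v ≫ θ
  d x := θ.app _ (c.d x)
  d_i x := by rw [c.d_i, app_res]
  compat v h := by rw [ev_comp, c.compat]

/-- A cocone is a colimit cocone. -/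
def Coc.IsUniv {G : Gr} {K : G.V → Gr} {b : ∀ v, G.Fl v → (K v).A} {S : Species}
    (c : Coc G K b S) : Prop :=
  ∀ (F : Species) (c' : Coc G K b F), ∃! k : S ⟶ F,
    (∀ v, c.γ v ≫ k = c'.γ v) ∧ ∀ x, k.app _ (c.d x) = c'.d x

section glue

variable (G : Gr) (K : ∀ v, NGraph (G.Fl v))

/-- The arcs of a graph whose edge is an inner edge. -/
abbrev Gr.Inner (X : Gr) : Type := {a : X.A // ¬ X.IsPort a ∧ ¬ X.IsPort (X.i a)}

open Classical in
/-- The map from the arcs of the graph substituted for `v` to the arcs of the glued graph. Arcs of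
the glued graph are the arcs of `G` and the arcs of the inner edges of the graphs `K v`. -/
def glueA (v : G.V) (a : (K v).G.A) : G.A ⊕ (Σ v, (K v).G.Inner) :=
  if h : (K v).G.IsPort a then .inl (G.i (G.s ((K v).β.symm ⟨a, h⟩).1))
  else if h' : (K v).G.IsPort ((K v).G.i a) then .inl (G.s ((K v).β.symm ⟨_, h'⟩).1)
  else .inr ⟨v, a, h, h'⟩

variable {G K}

lemma NGraph.not_port_i {n : Type} (X : NGraph n) (x : n) : ¬ X.G.IsPort (X.G.i (X.port x)) :=
  fun h => X.eff.2 _ ⟨(X.β x).2, h⟩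

lemma glueA_port (v : G.V) (h : G.Fl v) : glueA G K v ((K v).port h) = .inl (G.i (G.s h.1)) := by
  have : (K v).G.IsPort ((K v).port h) := ((K v).β h).2
  rw [glueA, dif_pos this]
  simp [NGraph.port]

lemma glueA_i_port (v : G.V) (h : G.Fl v) :
    glueA G K v ((K v).G.i ((K v).port h)) = .inl (G.s h.1) := by
  have : (K v).G.IsPort ((K v).G.i ((K v).G.i ((K v).port h))) := by
    rw [Gr.i_i]; exact ((K v).β h).2
  rw [glueA, dif_neg ((K v).not_port_i h), dif_pos this]
  have : (K v).β.symm ⟨_, this⟩ = h := by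
    rw [Equiv.symm_apply_eq]
    exact Subtype.ext ((K v).G.i_i _)
  rw [this]

lemma glueA_inner (v : G.V) (a : (K v).G.Inner) : glueA G K v a.1 = .inr ⟨v, a⟩ := by
  rw [glueA, dif_neg a.2.1, dif_neg a.2.2]

lemma NGraph.arc_cases {n : Type} (X : NGraph n) (a : X.G.A) :
    (∃ x, a = X.port x) ∨ (∃ x, a = X.G.i (X.port x)) ∨ ∃ y : X.G.Inner, a = y.1 := by
  by_cases h : X.G.IsPort a
  · exact .inl ⟨X.β.symm ⟨a, h⟩, by simp [NGraph.port]⟩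
  by_cases h' : X.G.IsPort (X.G.i a)
  · exact .inr (.inl ⟨X.β.symm ⟨_, h'⟩, by simp [NGraph.port, Gr.i_i]⟩)
  · exact .inr (.inr ⟨⟨a, h, h'⟩, rfl⟩)

lemma Gr.not_port_s (X : Gr) (h : X.H) : ¬ X.IsPort (X.s h) := fun h' => h' ⟨h, rfl⟩

variable (G K)

/-- The involution on the arcs of the glued graph. -/
def glueI : G.A ⊕ (Σ v, (K v).G.Inner) → G.A ⊕ (Σ v, (K v).G.Inner)
  | .inl x => .inl (G.i x)
  | .inr ⟨v, a⟩ => .inr ⟨v, (K v).G.i a.1, a.2.2, by rw [Gr.i_i]; exact a.2.1⟩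

lemma glueA_i (v : G.V) (a : (K v).G.A) :
    glueA G K v ((K v).G.i a) = glueI G K (glueA G K v a) := by
  obtain ⟨x, rfl⟩ | ⟨x, rfl⟩ | ⟨y, rfl⟩ := (K v).arc_cases a
  · rw [glueA_port, glueA_i_port, glueI, Gr.i_i]
  · rw [Gr.i_i, glueA_port, glueA_i_port, glueI]
  · rw [glueA_inner v y, glueI]
    exact glueA_inner v ⟨_, _⟩

lemma glueA_s_inj (v v' : G.V) (h : (K v).G.H) (h' : (K v').G.H)
    (e : glueA G K v ((K v).G.s h) = glueA G K v' ((K v').G.s h')) :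
    (⟨v, h⟩ : Σ v, (K v).G.H) = ⟨v', h'⟩ := by
  obtain ⟨x, hx⟩ | ⟨x, hx⟩ | ⟨y, hy⟩ := (K v).arc_cases ((K v).G.s h)
  · exact ((K v).G.not_port_s h (hx ▸ ((K v).β x).2)).elim
  · obtain ⟨x', hx'⟩ | ⟨x', hx'⟩ | ⟨y', hy'⟩ := (K v').arc_cases ((K v').G.s h')
    · exact ((K v').G.not_port_s h' (hx' ▸ ((K v').β x').2)).elim
    · rw [hx, hx', glueA_i_port, glueA_i_port, Sum.inl.injEq] at e
      have e' := G.s_inj e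
      obtain ⟨x, rfl⟩ := x
      obtain ⟨x', rfl⟩ := x'
      cases e'
      rw [← hx'] at hx
      cases (K _).G.s_inj hx
      rfl
    · rw [hx, hy', glueA_i_port, glueA_inner] at e
      cases e
  · obtain ⟨x', hx'⟩ | ⟨x', hx'⟩ | ⟨y', hy'⟩ := (K v').arc_cases ((K v').G.s h')
    · exact ((K v').G.not_port_s h' (hx' ▸ ((K v').β x').2)).elim
    · rw [hx', hy, glueA_i_port, glueA_inner] at e
      cases e
    · rw [hy, hy', glueA_inner, glueA_inner, Sum.inr.injEq] at e
      cases e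
      rw [← hy'] at hy
      cases (K _).G.s_inj hy
      rfl

/-- The graph obtained by gluing the graphs `K v` according to the same recipe by which `G` is
glued from its corollas: the port of `K v` labelled by a flag `h` at `v` is identified with the arc
of `G` at `h` pointing towards `v`. -/
def glue : Gr where
  A := G.A ⊕ (Σ v, (K v).G.Inner)
  H := Σ v, (K v).G.H
  V := Σ v, (K v).G.V
  finA := by
    have := G.finA; have := G.finV; have := fun v => (K v).G.finA
    infer_instance
  finH := by
    have := G.finV; have := fun v => (K v).G.finH
    infer_instance
  finV := by
    have := G.finV; have := fun v => (K v).G.finV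
    infer_instance
  i := glueI G K
  s := fun h => glueA G K h.1 ((K h.1).G.s h.2)
  p := fun h => ⟨h.1, (K h.1).G.p h.2⟩
  i_i := by
    rintro (x | ⟨v, a⟩)
    · simp [glueI, Gr.i_i]
    · simp [glueI, Gr.i_i]
  i_ne := by
    rintro (x | ⟨v, a⟩) h
    · exact G.i_ne x (Sum.inl.inj h)
    · simp only [glueI, Sum.inr.injEq, Sigma.mk.injEq, heq_eq_eq, true_and] at h
      exact (K v).G.i_ne a.1 (congrArg Subtype.val h)
  s_inj := fun h h' e => glueA_s_inj G K h.1 h'.1 h.2 h'.2 e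

/-- The etale morphism from `K v` to the glued graph. -/
def glueQ (v : G.V) : (K v).G ⟶ glue G K where
  a := glueA G K v
  h := fun h => ⟨v, h⟩
  v := fun w => ⟨v, w⟩
  a_i := glueA_i G K v
  a_s := fun _ => rfl
  v_p := fun _ => rfl
  cart := by
    rintro w ⟨v', h⟩ hh
    cases hh
    exact ⟨h, ⟨rfl, rfl⟩, fun y hy => by cases hy.2; rfl⟩

lemma glue_isPort_inl (x : G.A) : (glue G K).IsPort (.inl x) ↔ G.IsPort x := by
  rw [← not_iff_not]
  simp only [Gr.IsPort, not_not, Set.mem_range]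
  constructor
  · rintro ⟨⟨v, h⟩, hh⟩
    change glueA G K v _ = _ at hh
    obtain ⟨x, hx⟩ | ⟨x, hx⟩ | ⟨y, hy⟩ := (K v).arc_cases ((K v).G.s h)
    · exact ((K v).G.not_port_s h (hx ▸ ((K v).β x).2)).elim
    · rw [hx, glueA_i_port] at hh
      exact ⟨_, Sum.inl.inj hh⟩
    · rw [hy, glueA_inner] at hh
      cases hh
  · rintro ⟨h, rfl⟩
    have := (K (G.p h)).not_port_i ⟨h, rfl⟩
    rw [Gr.IsPort, not_not] at this
    obtain ⟨h', hh'⟩ := this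
    refine ⟨⟨G.p h, h'⟩, ?_⟩
    change glueA G K _ _ = _
    rw [hh', glueA_i_port]

lemma glue_isPort_inr (x) : ¬ (glue G K).IsPort (.inr x) := by
  obtain ⟨v, y⟩ := x
  obtain ⟨h, hh⟩ := not_not.1 y.2.1
  refine not_not.2 ⟨⟨v, h⟩, ?_⟩
  change glueA G K v _ = _
  rw [hh, glueA_inner]

lemma glue_noIsolatedEdges (hG : G.NoIsolatedEdges) : (glue G K).NoIsolatedEdges := by
  rintro (x | x) ⟨h1, h2⟩
  · rw [glue_isPort_inl] at h1
    change (glue G K).IsPort (.inl (G.i x)) at h2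
    rw [glue_isPort_inl] at h2
    exact hG x ⟨h1, h2⟩
  · exact glue_isPort_inr G K x h1

lemma glue_effective (hG : G.Effective) : (glue G K).Effective := by
  refine ⟨?_, glue_noIsolatedEdges G K hG.2⟩
  obtain ⟨⟨⟨x⟩⟩ | ⟨⟨v⟩⟩, _⟩ := hG
  · exact .inl ⟨.inl x⟩
  · obtain ⟨⟨⟨x⟩⟩ | ⟨⟨w⟩⟩, _⟩ := (K v).eff
    · exact .inl ⟨glueA G K v x⟩
    · exact .inr ⟨⟨v, w⟩⟩

/-- The glued graph has the same ports as `G`. -/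
def gluePorts : {a : G.A // G.IsPort a} ≃ {a // (glue G K).IsPort a} :=
  Equiv.ofBijective (fun a => ⟨.inl a.1, (glue_isPort_inl G K a.1).2 a.2⟩) <| by
    constructor
    · intro a b h
      exact Subtype.ext (Sum.inl.inj (congrArg Subtype.val h))
    · rintro ⟨x | x, h⟩
      · exact ⟨⟨x, (glue_isPort_inl G K x).1 h⟩, rfl⟩
      · exact (glue_isPort_inr G K x h).elim

/-- The canonical cocone on the glued graph. -/
def glueCoc : Coc G (fun v => (K v).G) (fun v => (K v).port) (yo.obj (glue G K)) where
  γ v := yo.map (glueQ G K v)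
  d x := ⟨(glue G K).arc (.inl x)⟩
  d_i _ := congrArg ULift.up (unit_hom_ext rfl)
  compat v h := congrArg ULift.up (unit_hom_ext (glueA_port v h))

lemma glueCoc_isUniv : (glueCoc G K).IsUniv := by
  intro F c'
  let d : (glue G K).A → F.obj (.op .unit) :=
    Sum.elim c'.d fun y => ev (c'.γ y.1) ((K y.1).G.arc y.2.1)
  have hd : ∀ v (a : (K v).G.A), d (glueA G K v a) = ev (c'.γ v) ((K v).G.arc a) := by
    intro v a
    obtain ⟨x, rfl⟩ | ⟨x, rfl⟩ | ⟨y, rfl⟩ := (K v).arc_cases a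
    · rw [glueA_port, c'.compat]; rfl
    · rw [glueA_i_port, ev_arc_i, c'.compat, ← c'.d_i, Gr.i_i]; rfl
    · rw [glueA_inner]; rfl
  let L : ∀ w : (glue G K).V, ((glue G K).elAt w).gr ⟶ (K w.1).G := fun w =>
    lift (glueQ G K w.1) ((glue G K).corAt w) w.2 rfl
  have hL : ∀ w, L w ≫ glueQ G K w.1 = (glue G K).corAt w := fun w => lift_comp _ _ _ _
  let D : DecData (glue G K) F :=
    { d := d
      c := fun w => ev (c'.γ w.1) (L w)
      d_i := by
        rintro (x | ⟨v, y⟩)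
        · exact c'.d_i x
        · exact ev_arc_i (c'.γ v) y.1
      d_s := fun w h => by
        rw [res_ev]
        refine Eq.trans ?_ (congrArg (ev (c'.γ w.1)) (out_comp (L w) h).symm)
        rw [← hd]
        refine congrArg d ?_
        have : h.1 = (glueQ G K w.1).h ((L w).h h) :=
          (congrArg (fun t : ((glue G K).elAt w).gr ⟶ glue G K => t.h h) (hL w)).symm
        rw [this]
        exact ((glueQ G K w.1).a_s _).symm }
  refine ⟨D.hom, ⟨fun v => ?_, fun _ => rfl⟩, ?_⟩
  · refine dec_ext (fun a => ?_) (fun w => ?_)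
    · change ev D.hom ((K v).G.arc a ≫ glueQ G K v) = _
      rw [arc_comp, D.hom_arc]
      exact hd v a
    · change ev D.hom ((K v).G.corAt w ≫ glueQ G K v) = _
      let u := (K v).G.corAt w ≫ glueQ G K v
      change F.res (fac u) (ev (c'.γ v) (L ⟨v, w⟩)) = _
      refine (res_ev (c'.γ v) (fac u) (L ⟨v, w⟩)).trans ?_
      refine congrArg (ev (c'.γ v)) ?_
      let r : ((K v).G.elAt w).gr ⟶ ((glue G K).elAt ⟨v, w⟩).gr := fac u
      have h1 : (r ≫ L ⟨v, w⟩) ≫ glueQ G K v = u := by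
        rw [Category.assoc, hL ⟨v, w⟩]
        exact fac_comp u
      exact (lift_unique (glueQ G K v) u w rfl _ h1 rfl).trans
        (lift_unique (glueQ G K v) u w rfl ((K v).G.corAt w) rfl rfl).symm
  · rintro k ⟨hk1, hk2⟩
    refine dec_ext ?_ (fun w => ?_)
    · rintro (x | ⟨v, y⟩)
      · exact hk2 x
      · have : (glue G K).arc (.inr ⟨v, y⟩) = (K v).G.arc y.1 ≫ glueQ G K v :=
          unit_hom_ext (glueA_inner v y).symm
        refine (congrArg (ev k) this).trans ?_
        exact congrArg (fun t => ev t ((K v).G.arc y.1)) (hk1 v)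
    · rw [D.hom_cor, ← hL w, ← ev_yo]
      exact congrArg (fun t => ev t (L w)) (hk1 w.1)

end glue

/-- The colimit of the cocone shape, as a morphism out of the glued graph. -/
def glueDesc {G : Gr} {K : ∀ v, NGraph (G.Fl v)} {F : Species}
    (c : Coc G (fun v => (K v).G) (fun v => (K v).port) F) : yo.obj (glue G K) ⟶ F :=
  (glueCoc_isUniv G K F c).choose

section
variable {G : Gr} {K : ∀ v, NGraph (G.Fl v)} {F : Species}
    (c : Coc G (fun v => (K v).G) (fun v => (K v).port) F)

lemma glueDesc_q (v : G.V) : yo.map (glueQ G K v) ≫ glueDesc c = c.γ v :=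
  (glueCoc_isUniv G K F c).choose_spec.1.1 v

lemma glueDesc_d (x : G.A) : ev (glueDesc c) ((glue G K).arc (.inl x)) = c.d x :=
  (glueCoc_isUniv G K F c).choose_spec.1.2 x

end

/-! The monad. -/

namespace DGraph

variable {n m : Type} {F F' : Species}

/-- Isomorphism of decorated `n`-graphs: an isomorphism of graphs leaving the ports fixed and
compatible with the decorations. -/
def Rel (X Y : DGraph n F) : Prop :=
  ∃ e : X.G ≅ Y.G, (∀ x, e.hom.a (X.port x) = Y.port x) ∧ yo.map e.hom ≫ Y.γ = X.γ

/-- Isomorphism of decorated `n`-graphs, as an equivalence relation. -/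
def setoid (n : Type) (F : Species) : Setoid (DGraph n F) where
  r := Rel
  iseqv :=
    { refl := fun X => ⟨Iso.refl _, fun _ => rfl, by simp⟩
      symm := by
        rintro X Y ⟨e, h1, h2⟩
        refine ⟨e.symm, fun x => ?_, ?_⟩
        · rw [← h1, ← comp_a]; simp
        · rw [← h2, ← Category.assoc, ← Functor.map_comp]; simp
      trans := by
        rintro X Y Z ⟨e, h1, h2⟩ ⟨e', h1', h2'⟩
        refine ⟨e ≪≫ e', fun x => ?_, ?_⟩
        · rw [← h1', ← h1]; rfl
        · rw [← h2, ← h2']; simp }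

/-- The set of isomorphism classes of decorated `n`-graphs. -/
abbrev Cls (n : Type) (F : Species) : Type 1 := Quotient (setoid n F)

/-- The isomorphism class of a decorated `n`-graph. -/
abbrev cls (X : DGraph n F) : Cls n F := Quotient.mk (setoid n F) X

lemma cls_eq {X Y : DGraph n F} : X.cls = Y.cls ↔ Rel X Y :=
  ⟨fun h => Quotient.exact h, fun h => Quotient.sound h⟩

end DGraph

/-- Relabelling the ports. -/
def NGraph.relabel {n m : Type} (e : m ≃ n) (X : NGraph n) : NGraph m where
  G := X.G
  eff := X.eff
  β := e.trans X.β

/-- All arcs of the corolla `n` give arcs of an `n`-graph. -/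
def NGraph.arcOf {n : Type} (X : NGraph n) : n ⊕ n → X.G.A :=
  Sum.elim X.port (fun x => X.G.i (X.port x))

lemma NGraph.arcOf_swap {n : Type} (X : NGraph n) (x : n ⊕ n) :
    X.arcOf x.swap = X.G.i (X.arcOf x) := by
  cases x <;> simp [arcOf, Gr.i_i]

namespace DGraph

variable {n m : Type} {F F' : Species}

/-- Relabelling the ports. -/
def relabel (e : m ≃ n) (X : DGraph n F) : DGraph m F where
  toNGraph := X.toNGraph.relabel e
  γ := X.γ

/-- Applying a morphism of species to the decorations. -/
def push (θ : F ⟶ F') (X : DGraph n F) : DGraph n F' where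
  toNGraph := X.toNGraph
  γ := X.γ ≫ θ

lemma relabel_rel (e : m ≃ n) {X Y : DGraph n F} (h : Rel X Y) :
    Rel (X.relabel e) (Y.relabel e) := by
  obtain ⟨f, h1, h2⟩ := h
  exact ⟨f, fun x => h1 (e x), h2⟩

lemma push_rel (θ : F ⟶ F') {X Y : DGraph n F} (h : Rel X Y) : Rel (X.push θ) (Y.push θ) := by
  obtain ⟨f, h1, h2⟩ := h
  refine ⟨f, h1, ?_⟩
  exact (Category.assoc _ _ _).symm.trans (congrArg (· ≫ θ) h2)

lemma rel_of_eq {X Y : DGraph n F} (hG : X.G = Y.G) (hp : ∀ x, HEq (X.port x) (Y.port x))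
    (hγ : HEq X.γ Y.γ) : Rel X Y := by
  obtain ⟨⟨G, _, β⟩, γ⟩ := X
  obtain ⟨⟨G', _, β'⟩, γ'⟩ := Y
  cases hG
  cases hγ
  exact ⟨Iso.refl _, fun x => eq_of_heq (hp x), by simp⟩

/-- The value of the decoration at an arc of the corolla. -/
def valAt (X : DGraph n F) (x : n ⊕ n) : F.obj (.op .unit) := ev X.γ (X.G.arc (X.arcOf x))

lemma valAt_rel (x : n ⊕ n) {X Y : DGraph n F} (h : Rel X Y) : X.valAt x = Y.valAt x := by
  obtain ⟨f, h1, h2⟩ := h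
  rw [valAt, ← h2, ev_yo, arc_comp, valAt]
  congr 2
  cases x with
  | inl x => exact h1 x
  | inr x => exact (f.hom.a_i _).trans (congrArg Y.G.i (h1 x))

lemma valAt_swap (x : n ⊕ n) (X : DGraph n F) : X.valAt x.swap = F.res rev (X.valAt x) := by
  rw [valAt, NGraph.arcOf_swap, ev_arc_i, valAt]

end DGraph

/-- A morphism of corollas is a bijection of the sets of ports. -/
def equivOf {n m : Type} {hn : Finite n} {hm : Finite m} (u : El.cor m hm ⟶ El.cor n hn) : m ≃ n :=
  Equiv.ofBijective (Gr.Hom.h u) (by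
    have hu := Gr.Hom.cart u ()
    constructor
    · intro x y hxy
      exact (hu (Gr.Hom.h u y) rfl).unique ⟨rfl, hxy⟩ ⟨rfl, rfl⟩
    · intro y
      obtain ⟨x, hx, _⟩ := hu y rfl
      exact ⟨x, hx.2⟩)

lemma cor_a {n m : Type} {hn : Finite n} {hm : Finite m} (u : El.cor m hm ⟶ El.cor n hn)
    (x : m ⊕ m) : Gr.Hom.a u x = Sum.map (equivOf u) (equivOf u) x := by
  cases x with
  | inr x => exact Gr.Hom.a_s u x
  | inl x => exact (Gr.Hom.a_i u (Sum.inr x)).trans (congrArg Sum.swap (Gr.Hom.a_s u x))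

/-- The values of the species `bar F`: the same colours as `F`, and as `n`-operations the
isomorphism classes of effective `n`-graphs decorated by `F`. -/
def BarVal (F : Species) : El → Type 1
  | .unit => F.obj (.op .unit)
  | .cor n _ => DGraph.Cls n F

/-- The restriction maps of the species `bar F`. -/
def barRes (F : Species) : ∀ {E E' : El}, (E' ⟶ E) → BarVal F E → BarVal F E'
  | .unit, .unit, u => F.res u
  | .unit, .cor _ _, u => (Gr.Hom.v u ()).elim
  | .cor _ _, .unit, u => Quotient.lift (fun X => X.valAt (Gr.Hom.a u true))
      (fun _ _ h => DGraph.valAt_rel _ h)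
  | .cor _ _, .cor _ _, u => Quotient.map (DGraph.relabel (equivOf u))
      (fun _ _ h => DGraph.relabel_rel _ h)

lemma barRes_id (F : Species) (E : El) (x : BarVal F E) : barRes F (𝟙 E) x = x := by
  match E, x with
  | .unit, x => exact res_id F x
  | .cor n hn, x =>
    induction x using Quotient.ind with | _ X
    exact Quotient.sound (DGraph.rel_of_eq rfl (fun _ => HEq.rfl) HEq.rfl)

lemma barRes_comp (F : Species) {E E' E'' : El} (u : E' ⟶ E) (w : E'' ⟶ E') (x : BarVal F E) :
    barRes F (w ≫ u) x = barRes F w (barRes F u x) := by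
  match E, E', E'', u, w, x with
  | .unit, .unit, .unit, u, w, x => exact (res_res F u w x).symm
  | .unit, .unit, .cor _ _, u, w, x => exact (Gr.Hom.v w ()).elim
  | .unit, .cor _ _, _, u, w, x => exact (Gr.Hom.v u ()).elim
  | .cor _ _, .unit, .cor _ _, u, w, x => exact (Gr.Hom.v w ()).elim
  | .cor n hn, .unit, .unit, u, w, x =>
    induction x using Quotient.ind with | _ X
    change X.valAt (Gr.Hom.a u (Gr.Hom.a w true)) = F.res w (X.valAt (Gr.Hom.a u true))
    cases hb : Gr.Hom.a w true with
    | true =>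
      have : w = 𝟙 El.unit := unit_hom_ext hb
      rw [this, res_id]
    | false =>
      have : w = rev := unit_hom_ext hb
      rw [this, ← DGraph.valAt_swap]
      exact congrArg X.valAt (Gr.Hom.a_i u true)
  | .cor n hn, .cor m hm, .unit, u, w, x =>
    induction x using Quotient.ind with | _ X
    change X.valAt (Gr.Hom.a u (Gr.Hom.a w true)) =
      (X.relabel (equivOf u)).valAt (Gr.Hom.a w true)
    rw [cor_a]
    generalize Gr.Hom.a w true = b
    cases b <;> rfl
  | .cor n hn, .cor m hm, .cor k hk, u, w, x =>
    induction x using Quotient.ind with | _ X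
    exact Quotient.sound (DGraph.rel_of_eq rfl (fun _ => HEq.rfl) HEq.rfl)

/-- The species of isomorphism classes of effective graphs decorated by `F`. -/
def bar (F : Species) : Species where
  obj E := BarVal F E.unop
  map u := TypeCat.ofHom (barRes F u.unop)
  map_id E := by ext x; exact barRes_id F E.unop x
  map_comp u w := by ext x; exact barRes_comp F u.unop w.unop x

/-- The functoriality of `bar`, on values. -/
def barApp {F F' : Species} (θ : F ⟶ F') : ∀ E : El, BarVal F E → BarVal F' E
  | .unit => θ.app (.op .unit)
  | .cor _ _ => Quotient.map (DGraph.push θ) (fun _ _ h => DGraph.push_rel θ h)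

/-- Morphisms of the form `bar F ⟶ F'` (constructor unfolding the definitions). -/
def barHomMk {F F' : Species} (f : ∀ E, BarVal F E → F'.obj (.op E))
    (hf : ∀ {E E' : El} (u : E' ⟶ E) (x : BarVal F E), f E' (barRes F u x) = F'.res u (f E x)) :
    bar F ⟶ F' where
  app E := TypeCat.ofHom (f E.unop)
  naturality E E' u := by ext x; exact hf u.unop x

/-- The functoriality of `bar`. -/
def barMap {F F' : Species} (θ : F ⟶ F') : bar F ⟶ bar F' :=
  barHomMk (barApp θ) (by
    intro E E' u x
    change _ = barRes F' u (barApp θ E x)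
    match E, E', u, x with
    | .unit, .unit, u, x => exact app_res θ u x
    | .unit, .cor _ _, u, x => exact (Gr.Hom.v u ()).elim
    | .cor _ _, .unit, u, x =>
      induction x using Quotient.ind with | _ X
      rfl
    | .cor _ _, .cor _ _, u, x =>
      induction x using Quotient.ind with | _ X
      rfl)

lemma bar_ext {F F' : Species} {f g : bar F ⟶ F'}
    (h1 : ∀ x : F.obj (.op .unit), f.app (.op .unit) x = g.app (.op .unit) x)
    (h2 : ∀ (n : Type) (hn : Finite n) (X : DGraph n F),
      f.app (.op (.cor n hn)) X.cls = g.app (.op (.cor n hn)) X.cls) : f = g := by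
  ext E x
  induction E using Opposite.rec with | _ E
  match E, x with
  | .unit, x => exact h1 x
  | .cor n hn, x =>
    induction x using Quotient.ind with | _ X
    exact h2 n hn X

/-- The functor `F ↦ bar F`, with `bar F` having the same colours as `F` and, as `n`-operations, the
isomorphism classes of effective `n`-graphs decorated by `F`. -/
def barFunctor : Species ⥤ Species where
  obj := bar
  map := barMap
  map_id _ := bar_ext (fun _ => rfl) fun _ _ _ =>
    Quotient.sound (DGraph.rel_of_eq rfl (fun _ => HEq.rfl) HEq.rfl)
  map_comp _ _ := bar_ext (fun _ => rfl) fun _ _ _ =>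
    Quotient.sound (DGraph.rel_of_eq rfl (fun _ => HEq.rfl) HEq.rfl)

section cocones

/-- The map on corollas induced by an etale morphism. -/
def atMap {X Y : Gr} (f : X ⟶ Y) (w : X.V) : X.elAt w ⟶ Y.elAt (f.v w) :=
  fac (X.corAt w ≫ f)

lemma atMap_comp {X Y : Gr} (f : X ⟶ Y) (w : X.V) :
    (show (X.elAt w).gr ⟶ (Y.elAt (f.v w)).gr from atMap f w) ≫ Y.corAt (f.v w) =
      X.corAt w ≫ f :=
  fac_comp _

lemma equivOf_atMap {X Y : Gr} (f : X ⟶ Y) (w : X.V) (h : X.Fl w) :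
    (equivOf (atMap f w) h).1 = f.h h.1 :=
  congrArg (fun t : (X.elAt w).gr ⟶ Y => t.h h) (atMap_comp f w)

/-- A morphism of species `δ : G ⟶ bar F`, together with representatives for its values at the
vertices of `G`, gives a cocone. -/
def cocOf {G : Gr} {F : Species} (δ : yo.obj G ⟶ bar F) (K : ∀ v, DGraph (G.Fl v) F)
    (hK : ∀ v, (K v).cls = ev δ (G.corAt v)) :
    Coc G (fun v => (K v).G) (fun v => (K v).port) F where
  γ v := (K v).γ
  d x := ev δ (G.arc x)
  d_i x := ev_arc_i δ x
  compat v h := by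
    have h1 : (bar F).res (rev ≫ out h) (ev δ (G.corAt v)) = ev δ (G.arc (G.i (G.s h.1))) := by
      rw [← res_res, ← ev_arc_s, ← ev_arc_i]
    rw [← h1, ← hK, rev_out]
    rfl

variable {G : Gr} {F : Species}

/-- Conversely, cocones define morphisms of species into `bar F`. -/
def toBar (K : ∀ v, NGraph (G.Fl v)) (c : Coc G (fun v => (K v).G) (fun v => (K v).port) F) :
    yo.obj G ⟶ bar F :=
  DecData.hom
    { d := c.d
      c := fun w => DGraph.cls ⟨K w, c.γ w⟩
      d_i := c.d_i
      d_s := fun w h => by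
        change c.d (G.s h.1) = ev (c.γ w) ((K w).G.arc ((K w).G.i ((K w).port h)))
        rw [ev_arc_i, c.compat, ← c.d_i, Gr.i_i] }

lemma toBar_arc (K : ∀ v, NGraph (G.Fl v))
    (c : Coc G (fun v => (K v).G) (fun v => (K v).port) F) (x : G.A) :
    ev (toBar K c) (G.arc x) = c.d x := rfl

lemma toBar_cor (K : ∀ v, NGraph (G.Fl v))
    (c : Coc G (fun v => (K v).G) (fun v => (K v).port) F) (w : G.V) :
    ev (toBar K c) (G.corAt w) = DGraph.cls ⟨K w, c.γ w⟩ := DecData.hom_cor _ w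

/-- Restriction of the substituted graphs along an etale morphism. -/
def pullN {X : Gr} (f : X ⟶ G) (M : ∀ y, NGraph (G.Fl y)) (w : X.V) : NGraph (X.Fl w) :=
  (M (f.v w)).relabel (equivOf (atMap f w))

/-- Restriction of a cocone along an etale morphism. -/
def Coc.pull {X : Gr} (f : X ⟶ G) {M : ∀ y, NGraph (G.Fl y)}
    (c : Coc G (fun v => (M v).G) (fun v => (M v).port) F) :
    Coc X (fun w => (pullN f M w).G) (fun w => (pullN f M w).port) F where
  γ w := c.γ (f.v w)
  d x := c.d (f.a x)
  d_i x := by rw [f.a_i, c.d_i]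
  compat w h := by
    refine (c.compat (f.v w) (equivOf (atMap f w) h)).trans (congrArg c.d ?_)
    rw [f.a_i, f.a_s, equivOf_atMap]

lemma toBar_pull {X : Gr} (f : X ⟶ G) (M : ∀ y, NGraph (G.Fl y))
    (c : Coc G (fun v => (M v).G) (fun v => (M v).port) F) :
    toBar (pullN f M) (c.pull f) = yo.map f ≫ toBar M c := by
  refine dec_ext (fun a => ?_) (fun w => ?_)
  · rw [ev_yo, arc_comp]
    rfl
  · rw [ev_yo, ← atMap_comp, ← res_ev, toBar_cor, toBar_cor]
    rfl

lemma Coc.ext_hom {K : G.V → Gr} {b : ∀ v, G.Fl v → (K v).A} {S : Species}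
    {c : Coc G K b S} (hc : c.IsUniv) {k k' : S ⟶ F} (h1 : ∀ v, c.γ v ≫ k = c.γ v ≫ k')
    (h2 : ∀ x, k.app _ (c.d x) = k'.app _ (c.d x)) : k = k' :=
  (hc F (c.push k')).unique ⟨h1, h2⟩ ⟨fun _ => rfl, fun _ => rfl⟩

lemma Coc.uniq {K : G.V → Gr} {b : ∀ v, G.Fl v → (K v).A} {S S' : Gr}
    {c : Coc G K b (yo.obj S)} (hc : c.IsUniv) {c' : Coc G K b (yo.obj S')} (hc' : c'.IsUniv) :
    ∃ e : S ≅ S', (∀ v, c.γ v ≫ yo.map e.hom = c'.γ v) ∧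
      ∀ x, (yo.map e.hom).app _ (c.d x) = c'.d x := by
  obtain ⟨k, ⟨k1, k2⟩, -⟩ := hc _ c'
  obtain ⟨l, ⟨l1, l2⟩, -⟩ := hc' _ c
  have kl : k ≫ l = 𝟙 _ := Coc.ext_hom hc
    (fun v => by rw [← Category.assoc, k1, l1, Category.comp_id])
    (fun x => by
      change l.app _ (k.app _ (c.d x)) = c.d x
      rw [k2, l2])
  have lk : l ≫ k = 𝟙 _ := Coc.ext_hom hc'
    (fun v => by rw [← Category.assoc, l1, k1, Category.comp_id])
    (fun x => by
      change k.app _ (l.app _ (c'.d x)) = c'.d x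
      rw [l2, k2])
  refine ⟨⟨unyo k, unyo l, yo_injective ?_, yo_injective ?_⟩, ?_⟩
  · rw [yo.map_comp, yo_unyo, yo_unyo, kl, yo.map_id]
  · rw [yo.map_comp, yo_unyo, yo_unyo, lk, yo.map_id]
  · simp only [yo_unyo]
    exact ⟨k1, k2⟩

/-- Replacing the graphs in a cocone by isomorphic ones. -/
def Coc.reidx {K K' : G.V → Gr} {b : ∀ v, G.Fl v → (K v).A} {b' : ∀ v, G.Fl v → (K' v).A}
    (f : ∀ v, K' v ≅ K v) (hf : ∀ v h, (f v).hom.a (b' v h) = b v h) (c : Coc G K b F) :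
    Coc G K' b' F where
  γ v := yo.map (f v).hom ≫ c.γ v
  d := c.d
  d_i := c.d_i
  compat v h := by rw [ev_yo, arc_comp, hf, c.compat]

lemma Coc.reidx_isUniv {K K' : G.V → Gr} {b : ∀ v, G.Fl v → (K v).A}
    {b' : ∀ v, G.Fl v → (K' v).A} (f : ∀ v, K' v ≅ K v)
    (hf : ∀ v h, (f v).hom.a (b' v h) = b v h) {S : Species} {c : Coc G K b S} (hc : c.IsUniv) :
    (c.reidx f hf).IsUniv := by
  intro F c'
  have hf' : ∀ v h, (f v).symm.hom.a (b v h) = b' v h := fun v h => by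
    rw [← hf, ← comp_a]; simp
  have key : ∀ v (k : S ⟶ F), (c.reidx f hf).γ v ≫ k = c'.γ v ↔
      c.γ v ≫ k = (c'.reidx (fun v => (f v).symm) hf').γ v := by
    intro v k
    change (yo.map (f v).hom ≫ c.γ v) ≫ k = _ ↔ _ = yo.map (f v).inv ≫ c'.γ v
    rw [Category.assoc]
    constructor
    · rintro h
      rw [← h, ← Category.assoc, ← yo.map_comp]; simp
    · rintro h
      rw [h, ← Category.assoc, ← yo.map_comp]; simp
  obtain ⟨k, ⟨k1, k2⟩, k3⟩ := hc F (c'.reidx (fun v => (f v).symm) hf')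
  exact ⟨k, ⟨fun v => (key v k).2 (k1 v), k2⟩, fun l hl => k3 l ⟨fun v => (key v l).1 (hl.1 v), hl.2⟩⟩

/-- Restricting a colimit cocone along an isomorphism gives a colimit cocone. -/
lemma Coc.pull_isUniv {X : Gr} (f : X ≅ G) {M : ∀ y, NGraph (G.Fl y)} {S : Species}
    {c : Coc G (fun v => (M v).G) (fun v => (M v).port) S} (hc : c.IsUniv) :
    (c.pull f.hom).IsUniv := by
  intro F c'
  have hv : ∀ v, f.hom.v (f.inv.v v) = v := fun v => by rw [← comp_v]; simp
  have hv' : ∀ v, f.inv.v (f.hom.v v) = v := fun v => by rw [← comp_v]; simp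
  have ha : ∀ v, f.hom.a (f.inv.a v) = v := fun v => by rw [← comp_a]; simp
  have ha' : ∀ v, f.inv.a (f.hom.a v) = v := fun v => by rw [← comp_a]; simp
  let eV : X.V ≃ G.V := ⟨f.hom.v, f.inv.v, hv', hv⟩
  let γ : ∀ v, yo.obj (M v).G ⟶ F :=
    Equiv.piCongrLeft (fun v => yo.obj (M v).G ⟶ F) eV c'.γ
  have hγ : ∀ v, γ (f.hom.v v) = c'.γ v :=
    Equiv.piCongrLeft_apply_apply (fun v => yo.obj (M v).G ⟶ F) eV c'.γ
  let c'' : Coc G (fun v => (M v).G) (fun v => (M v).port) F :=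
    { γ := γ
      d := fun x => c'.d (f.inv.a x)
      d_i := fun x => by rw [f.inv.a_i, c'.d_i]
      compat := fun v h => by
        obtain ⟨v, rfl⟩ := eV.surjective v
        obtain ⟨h, rfl⟩ := (equivOf (atMap f.hom v)).surjective h
        refine (congrArg (fun t => ev t _) (hγ v)).trans ((c'.compat v h).trans ?_)
        rw [equivOf_atMap, ← f.hom.a_s, ← f.hom.a_i, ha'] }
  obtain ⟨k, ⟨k1, k2⟩, k3⟩ := hc F c''
  refine ⟨k, ⟨fun v => (k1 (f.hom.v v)).trans (hγ v), fun x => ?_⟩, fun l hl => k3 l ⟨fun v => ?_, fun x => ?_⟩⟩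
  · exact (k2 (f.hom.a x)).trans (congrArg c'.d (ha' x))
  · obtain ⟨v, rfl⟩ := eV.surjective v
    exact (hl.1 v).trans (hγ v).symm
  · have := hl.2 (f.inv.a x)
    change l.app _ (c.d (f.hom.a (f.inv.a x))) = _ at this
    rwa [ha] at this

/-- Iterated colimits. -/
lemma Coc.iterate (K : ∀ v, NGraph (G.Fl v)) {S : Gr} (q : ∀ v, (K v).G ⟶ S) (a : G.A → S.A)
    (c : Coc G (fun v => (K v).G) (fun v => (K v).port) (yo.obj S)) (hc : c.IsUniv)
    (hq : ∀ v, c.γ v = yo.map (q v)) (ha : ∀ x, c.d x = ⟨S.arc (a x)⟩)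
    (hV : Function.Bijective (fun w : Σ v, (K v).G.V => (q w.1).v w.2))
    (M : ∀ y, NGraph (S.Fl y)) {Z : Species}
    (cM : Coc S (fun y => (M y).G) (fun y => (M y).port) Z) (hcM : cM.IsUniv)
    (P : G.V → Gr) (b : ∀ v, G.Fl v → (P v).A)
    (cP : ∀ v, Coc (K v).G (fun w => (pullN (q v) M w).G) (fun w => (pullN (q v) M w).port)
      (yo.obj (P v))) (hcP : ∀ v, (cP v).IsUniv)
    (hb : ∀ v h, (cP v).d ((K v).port h) = ⟨(P v).arc (b v h)⟩) :
    ∃ c' : Coc G P b Z, c'.IsUniv ∧ (∀ x, c'.d x = cM.d (a x)) ∧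
      (∀ v w, (cP v).γ w ≫ c'.γ v = cM.γ ((q v).v w)) ∧
      ∀ v x, (c'.γ v).app _ ((cP v).d x) = cM.d ((q v).a x) := by
  have hqa : ∀ v (h : G.Fl v), (q v).a ((K v).port h) = a (G.i (G.s h.1)) := by
    intro v h
    have := c.compat v h
    rw [hq, ha] at this
    exact congrArg (fun t : ULift (El.unit.gr ⟶ S) => t.down.a true) this
  have hai : ∀ x, a (G.i x) = S.i (a x) := by
    intro x
    have := c.d_i x
    rw [ha, ha] at this
    exact congrArg (fun t : ULift (El.unit.gr ⟶ S) => t.down.a true) this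
  choose g hg _ using fun v => hcP v Z (cM.pull (q v))
  let c' : Coc G P b Z :=
    { γ := g
      d := fun x => cM.d (a x)
      d_i := fun x => by rw [hai, cM.d_i]
      compat := fun v h => by
        rw [← hqa]
        refine Eq.trans ?_ ((hg v).2 ((K v).port h))
        rw [hb]; rfl }
  refine ⟨c', ?_, fun _ => rfl, fun v => (hg v).1, fun v => (hg v).2⟩
  intro F c₁
  have hδc : ∀ v x, ev (toBar (pullN (q v) M) ((cP v).push (c₁.γ v))) ((K v).G.arc x) =
      (c₁.γ v).app _ ((cP v).d x) := fun v x => rfl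
  let c₂ : Coc G (fun v => (K v).G) (fun v => (K v).port) (bar F) :=
    { γ := fun v => toBar (pullN (q v) M) ((cP v).push (c₁.γ v))
      d := c₁.d
      d_i := c₁.d_i
      compat := fun v h => by
        rw [hδc, hb]
        exact c₁.compat v h }
  obtain ⟨δ, ⟨δ1, δ2⟩, δ3⟩ := hc _ c₂
  have hδq : ∀ v x, ev δ (S.arc ((q v).a x)) = (c₁.γ v).app _ ((cP v).d x) := by
    intro v x
    rw [← hδc, ← arc_comp, ← ev_yo, ← hq]
    exact congrArg (fun t => ev t ((K v).G.arc x)) (δ1 v)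
  have hδa : ∀ x, ev δ (S.arc (a x)) = c₁.d x := by
    intro x
    refine Eq.trans ?_ (δ2 x)
    rw [ha]; rfl
  let eV : (Σ v, (K v).G.V) ≃ S.V := Equiv.ofBijective _ hV
  let γ : ∀ y, yo.obj (M y).G ⟶ F :=
    Equiv.piCongrLeft (fun y => yo.obj (M y).G ⟶ F) eV (fun w => (cP w.1).γ w.2 ≫ c₁.γ w.1)
  have hγ : ∀ v w, γ ((q v).v w) = (cP v).γ w ≫ c₁.γ v := fun v w =>
    Equiv.piCongrLeft_apply_apply (fun y => yo.obj (M y).G ⟶ F) eV _ ⟨v, w⟩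
  let c₃ : Coc S (fun y => (M y).G) (fun y => (M y).port) F :=
    { γ := γ
      d := fun x => ev δ (S.arc x)
      d_i := fun x => ev_arc_i δ x
      compat := fun y h => by
        obtain ⟨⟨v, w⟩, rfl⟩ := eV.surjective y
        obtain ⟨h, rfl⟩ := (equivOf (atMap (q v) w)).surjective h
        refine (congrArg (fun t => ev t _) (hγ v w)).trans ?_
        rw [equivOf_atMap, ← (q v).a_s, ← (q v).a_i, hδq]
        exact ((cP v).push (c₁.γ v)).compat w h }
  obtain ⟨k, ⟨k1, k2⟩, k3⟩ := hcM F c₃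
  refine ⟨k, ⟨fun v => Coc.ext_hom (hcP v) (fun w => ?_) (fun x => ?_), fun x => ?_⟩, ?_⟩
  · rw [← Category.assoc]
    refine (congrArg (· ≫ k) ((hg v).1 w)).trans ((k1 _).trans (hγ v w))
  · refine (congrArg (fun t => k.app _ t) ((hg v).2 x)).trans ((k2 _).trans (hδq v x))
  · exact (k2 (a x)).trans (hδa x)
  · rintro l ⟨l1, l2⟩
    have hl : ∀ v w, cM.γ ((q v).v w) ≫ l = (cP v).γ w ≫ c₁.γ v := fun v w => by
      rw [← l1, ← Category.assoc]
      exact congrArg (· ≫ l) ((hg v).1 w).symm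
    have hδ : toBar M (cM.push l) = δ := by
      refine δ3 _ ⟨fun v => ?_, fun x => ?_⟩
      · rw [hq, ← toBar_pull]
        refine dec_ext (fun x => ?_) (fun w => ?_)
        · rw [toBar_arc]
          change l.app _ (cM.d ((q v).a x)) = (c₁.γ v).app _ ((cP v).d x)
          rw [← l1]
          exact congrArg (fun t => l.app _ t) ((hg v).2 x).symm
        · rw [toBar_cor]
          refine Eq.trans ?_ (toBar_cor (pullN (q v) M) ((cP v).push (c₁.γ v)) w).symm
          exact congrArg (fun t => DGraph.cls ⟨pullN (q v) M w, t⟩) (hl v w)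
      · rw [ha]
        exact l2 x
    refine k3 l ⟨fun y => ?_, fun x => ?_⟩
    · obtain ⟨⟨v, w⟩, rfl⟩ := eV.surjective y
      exact (hl v w).trans (hγ v w).symm
    · change (toBar M (cM.push l)).app _ ⟨S.arc x⟩ = ev δ (S.arc x)
      rw [hδ]; rfl

end cocones

section multiplication

variable {n : Type} {F : Species}

/-- A representative of the decoration of a vertex. -/
def rep {G : Gr} (δ : yo.obj G ⟶ bar F) (v : G.V) : DGraph (G.Fl v) F :=
  Quotient.out (s := DGraph.setoid (G.Fl v) F) (ev δ (G.corAt v))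

lemma rep_cls {G : Gr} (δ : yo.obj G ⟶ bar F) (v : G.V) : (rep δ v).cls = ev δ (G.corAt v) :=
  Quotient.out_eq (s := DGraph.setoid (G.Fl v) F) _

/-- Given an `n`-graph `X` and an `F`-decorated graph `K v` for each vertex `v` of `X`, with matching
interfaces and colours, the colimit of the `K v` is an `F`-decorated `n`-graph. -/
def subst (X : DGraph n (bar F)) (K : ∀ v, DGraph (X.G.Fl v) F)
    (hK : ∀ v, (K v).cls = ev X.γ (X.G.corAt v)) : DGraph n F where
  G := glue X.G (fun v => (K v).toNGraph)
  eff := glue_effective _ _ X.eff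
  β := X.β.trans (gluePorts _ _)
  γ := glueDesc (cocOf X.γ K hK)

/-- Erasing the circles: the multiplication, on representatives. -/
def muFun (X : DGraph n (bar F)) : DGraph n F := subst X (rep X.γ) (rep_cls X.γ)

/-- Every colimit computes the multiplication. -/
lemma mu_eq (X : DGraph n (bar F)) (K : ∀ v, DGraph (X.G.Fl v) F)
    (hK : ∀ v, (K v).cls = ev X.γ (X.G.corAt v)) (Y : DGraph n F)
    (c : Coc X.G (fun v => (K v).G) (fun v => (K v).port) (yo.obj Y.G)) (hc : c.IsUniv)
    (hβ : ∀ x, c.d (X.port x) = ⟨Y.G.arc (Y.port x)⟩) (hγ : ∀ v, c.γ v ≫ Y.γ = (K v).γ)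
    (hd : ∀ x, Y.γ.app _ (c.d x) = ev X.γ (X.G.arc x)) : (muFun X).cls = Y.cls := by
  have hr : ∀ v, DGraph.Rel (rep X.γ v) (K v) := fun v =>
    DGraph.cls_eq.1 ((rep_cls X.γ v).trans (hK v).symm)
  choose f hf hfγ using hr
  let c₁ := c.reidx (b' := fun v => (rep X.γ v).port) f hf
  obtain ⟨e, e1, e2⟩ := Coc.uniq (glueCoc_isUniv X.G (fun v => (rep X.γ v).toNGraph))
    (c' := c₁) (Coc.reidx_isUniv f hf hc)
  refine DGraph.cls_eq.2 ⟨e, fun x => ?_, ?_⟩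
  · have := (e2 (X.port x)).trans (hβ x)
    exact congrArg (fun t : ULift (El.unit.gr ⟶ Y.G) => t.down.a true) this
  · refine Coc.ext_hom (glueCoc_isUniv X.G (fun v => (rep X.γ v).toNGraph)) (fun v => ?_)
      (fun x => ?_)
    · refine (Category.assoc _ _ _).symm.trans ((congrArg (· ≫ Y.γ) (e1 v)).trans ?_)
      change (yo.map (f v).hom ≫ c.γ v) ≫ Y.γ = _
      rw [Category.assoc, hγ, hfγ]
      exact (glueDesc_q (cocOf X.γ (rep X.γ) (rep_cls X.γ)) v).symm
    · refine (congrArg (fun t => Y.γ.app _ t) (e2 x)).trans ((hd x).trans ?_)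
      exact (glueDesc_d (cocOf X.γ (rep X.γ) (rep_cls X.γ)) x).symm

lemma mu_subst (X : DGraph n (bar F)) (K : ∀ v, DGraph (X.G.Fl v) F)
    (hK : ∀ v, (K v).cls = ev X.γ (X.G.corAt v)) : (muFun X).cls = (subst X K hK).cls :=
  mu_eq X K hK (subst X K hK) (glueCoc _ _) (glueCoc_isUniv _ _) (fun _ => rfl)
    (fun v => glueDesc_q (cocOf X.γ K hK) v) (fun x => glueDesc_d (cocOf X.γ K hK) x)

lemma muFun_rel {X X' : DGraph n (bar F)} (h : DGraph.Rel X X') :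
    DGraph.Rel (muFun X) (muFun X') := by
  obtain ⟨e, h1, h2⟩ := h
  refine DGraph.cls_eq.1 ?_
  let c : Coc X'.G (fun v => (rep X'.γ v).G) (fun v => (rep X'.γ v).port) (yo.obj (muFun X').G) :=
    glueCoc X'.G (fun v => (rep X'.γ v).toNGraph)
  have hc : c.IsUniv := glueCoc_isUniv X'.G (fun v => (rep X'.γ v).toNGraph)
  refine mu_eq X (fun v => (rep X'.γ (e.hom.v v)).relabel (equivOf (atMap e.hom v))) (fun v => ?_)
    (muFun X') (c.pull (M := fun v => (rep X'.γ v).toNGraph) e.hom)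
    (Coc.pull_isUniv (M := fun v => (rep X'.γ v).toNGraph) e hc) (fun x => ?_) (fun v => ?_)
    (fun x => ?_)
  · rw [← h2, ev_yo, ← atMap_comp, ← res_ev, ← rep_cls]
    rfl
  · change c.d (e.hom.a (X.port x)) = _
    rw [h1]
    rfl
  · exact glueDesc_q (cocOf X'.γ (rep X'.γ) (rep_cls X'.γ)) (e.hom.v v)
  · rw [← h2, ev_yo, arc_comp]
    exact glueDesc_d (cocOf X'.γ (rep X'.γ) (rep_cls X'.γ)) (e.hom.a x)

/-- The multiplication, on values. -/
def muVal (F : Species) : ∀ E, BarVal (bar F) E → BarVal F E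
  | .unit => id
  | .cor _ _ => Quotient.map muFun (fun _ _ h => muFun_rel h)

/-- The multiplication of the monad. -/
def muApp (F : Species) : bar (bar F) ⟶ bar F :=
  barHomMk (muVal F) (by
    intro E E' u x
    change _ = barRes F u (muVal F E x)
    match E, E', u, x with
    | .unit, .unit, u, x => rfl
    | .unit, .cor _ _, u, x => exact (Gr.Hom.v u ()).elim
    | .cor _ _, .unit, u, x =>
      induction x using Quotient.ind with | _ X
      change X.valAt (Gr.Hom.a u true) = (muFun X).valAt (Gr.Hom.a u true)
      generalize Gr.Hom.a u true = b
      have h := glueDesc_d (cocOf X.γ (rep X.γ) (rep_cls X.γ))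
      cases b with
      | inl x => exact (h _).symm
      | inr x => exact (h _).symm
    | .cor _ _, .cor _ _, u, x =>
      induction x using Quotient.ind with | _ X
      rfl)

/-- The morphism of species corresponding to an element by the Yoneda lemma. -/
def ofElt {E : El} (x : F.obj (.op E)) : yo.obj E.gr ⟶ F where
  app E' := TypeCat.ofHom fun u => F.res (E' := E'.unop) u.down x
  naturality E' E'' w := by
    ext u
    exact (res_res F (E' := E'.unop) (E'' := E''.unop) u.down w.unop x).symm

lemma corolla_effective (n : Type) (hn : Finite n) : (Gr.corolla n hn).Effective := by
  refine ⟨.inr ⟨()⟩, ?_⟩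
  rintro (x | x) ⟨h1, h2⟩
  · exact h2 ⟨x, rfl⟩
  · exact h1 ⟨x, rfl⟩

/-- A corolla as an `n`-graph. -/
def corN (n : Type) (hn : Finite n) : NGraph n where
  G := Gr.corolla n hn
  eff := corolla_effective n hn
  β := Equiv.ofBijective (fun x => ⟨Sum.inl x, fun ⟨y, hy⟩ => by cases hy⟩) <| by
    constructor
    · intro x y h
      exact Sum.inl.inj (congrArg Subtype.val h)
    · rintro ⟨x | x, h⟩
      · exact ⟨x, rfl⟩
      · exact (h ⟨x, rfl⟩).elim

/-- A decorated corolla. -/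
def etaFun {n : Type} (hn : Finite n) (x : F.obj (.op (.cor n hn))) : DGraph n F where
  toNGraph := corN n hn
  γ := ofElt x

/-- The unit of the monad, on values: an operation of `F` is interpreted as a decorated corolla. -/
def etaVal (F : Species) : ∀ E : El, F.obj (.op E) → BarVal F E
  | .unit => id
  | .cor _ hn => fun x => (etaFun hn x).cls

lemma arcOf_corN {n : Type} {hn : Finite n} (x : n ⊕ n) : (corN n hn).arcOf x = x := by
  cases x <;> rfl

/-- Isomorphism of corollas from a bijection of ports. -/
def corIso {n m : Type} {hn : Finite n} {hm : Finite m} (e : m ≃ n) :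
    Gr.corolla m hm ≅ Gr.corolla n hn where
  hom :=
    { a := Sum.map e e, h := e, v := id
      a_i := by rintro (x | x) <;> rfl
      a_s := fun _ => rfl
      v_p := fun _ => rfl
      cart := fun _ k _ => ⟨e.symm k, ⟨rfl, e.apply_symm_apply k⟩, fun y hy => by
        rw [← hy.2, e.symm_apply_apply]⟩ }
  inv :=
    { a := Sum.map e.symm e.symm, h := e.symm, v := id
      a_i := by rintro (x | x) <;> rfl
      a_s := fun _ => rfl
      v_p := fun _ => rfl
      cart := fun _ k _ => ⟨e k, ⟨rfl, e.symm_apply_apply k⟩, fun y hy => by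
        rw [← hy.2, e.apply_symm_apply]⟩ }
  hom_inv_id := cor_hom_ext (hn := hm) rfl fun x => e.symm_apply_apply x
  inv_hom_id := cor_hom_ext (hn := hn) rfl fun x => e.apply_symm_apply x

/-- The unit of the monad. -/
def etaApp (F : Species) : F ⟶ bar F where
  app E := TypeCat.ofHom (etaVal F E.unop)
  naturality E E' u := by
    induction E using Opposite.rec with | _ E
    induction E' using Opposite.rec with | _ E'
    obtain ⟨u, rfl⟩ : ∃ w : E' ⟶ E, u = w.op := ⟨u.unop, rfl⟩
    ext x
    change etaVal F E' (F.res u x) = barRes F u (etaVal F E x)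
    match E, E', u, x with
    | .unit, .unit, u, x => rfl
    | .unit, .cor _ _, u, x => exact (Gr.Hom.v u ()).elim
    | .cor n hn, .unit, u, x =>
      change F.res u x = F.res _ x
      congr 1
      exact unit_hom_ext (arcOf_corN (hn := hn) (Gr.Hom.a u true)).symm
    | .cor n hn, .cor m hm, u, x =>
      refine DGraph.cls_eq.2 ⟨corIso (equivOf u), fun x => rfl, ?_⟩
      have hu : (corIso (hn := hn) (hm := hm) (equivOf u)).hom = u := cor_hom_ext rfl fun _ => rfl
      refine ev_ext fun E t => ?_
      have key : ∀ z : Gr.corolla m hm ⟶ Gr.corolla n hn, z = u →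
          ev (yo.map z ≫ ofElt x) t = ev (ofElt (F.res u x)) t := by
        rintro z rfl
        exact (res_res F (E := El.cor n hn) (E' := El.cor m hm) z t x).symm
      exact key _ hu

lemma mu_eta_left {n : Type} (hn : Finite n) (X : DGraph n F) :
    (muFun (etaFun (F := bar F) hn X.cls)).cls = X.cls := by
  let G := Gr.corolla n hn
  let K : ∀ v : G.V, DGraph (G.Fl v) F := fun v => X.relabel (equivOf (hn := hn) (G.corAt v))
  let c : Coc G (fun v => (K v).G) (fun v => (K v).port) (yo.obj X.G) :=
    { γ := fun _ => 𝟙 _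
      d := fun x => ⟨X.G.arc (X.arcOf x)⟩
      d_i := fun x => congrArg ULift.up
        ((congrArg X.G.arc (X.arcOf_swap x)).trans (rev_comp_arc _ _).symm)
      compat := fun v h => rfl }
  have hc : c.IsUniv := by
    intro F' c'
    have h1 : ∀ x : n, ev (c'.γ ()) (X.G.arc (X.port x)) = c'.d (Sum.inl x) :=
      fun x => c'.compat () ⟨x, rfl⟩
    refine ⟨c'.γ (), ⟨fun v => Category.id_comp _, ?_⟩, fun k hk => ?_⟩
    · rintro (x | x)
      · exact h1 x
      · refine (ev_arc_i (c'.γ ()) (X.port x)).trans ?_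
        exact (congrArg (F'.res rev) (h1 x)).trans (c'.d_i (Sum.inl x)).symm
    · exact (Category.id_comp k).symm.trans (hk.1 ())
  exact mu_eq (etaFun (F := bar F) hn X.cls) K (fun v => rfl) X c hc (fun _ => rfl)
    (fun v => Category.id_comp _) (fun _ => rfl)

/-- The canonical cocone exhibiting a graph as the colimit of its corollas. -/
def corCoc (G : Gr) (y : ∀ v, F.obj (.op (G.elAt v))) :
    Coc G (fun v => (etaFun (G.finite_fl v) (y v)).G) (fun v => (etaFun (G.finite_fl v) (y v)).port)
      (yo.obj G) where
  γ v := yo.map (G.corAt v)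
  d x := ⟨G.arc x⟩
  d_i _ := congrArg ULift.up (rev_comp_arc _ _).symm
  compat _ _ := congrArg ULift.up (unit_hom_ext rfl)

lemma corCoc_isUniv (G : Gr) (y : ∀ v, F.obj (.op (G.elAt v))) : (corCoc G y).IsUniv := by
  intro F' c'
  let D : DecData G F' :=
    { d := c'.d
      c := fun w => ev (c'.γ w) (𝟙 _)
      d_i := c'.d_i
      d_s := fun w h => by
        have h1 : ev (c'.γ w) ((G.elAt w).gr.arc (Sum.inl h)) = c'.d (G.i (G.s h.1)) :=
          c'.compat w h
        refine Eq.trans ?_ (res_ev (c'.γ w) (out h) (𝟙 _)).symm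
        refine Eq.trans ?_ (ev_arc_i (c'.γ w) (Sum.inl h)).symm
        refine Eq.trans ?_ (congrArg (F'.res rev) h1).symm
        rw [← c'.d_i, Gr.i_i] }
  refine ⟨D.hom, ⟨fun v => ?_, fun x => rfl⟩, fun k hk => ?_⟩
  · refine ev_ext fun E u => ?_
    have h1 : _ = ev (yo.map (G.corAt v) ≫ D.hom) u :=
      res_ev (yo.map (G.corAt v) ≫ D.hom) (E := G.elAt v) u (𝟙 _)
    have h2 : _ = ev (c'.γ v) u := res_ev (c'.γ v) (E := G.elAt v) u (𝟙 _)
    have h3 : ev (yo.map (G.corAt v) ≫ D.hom) (𝟙 (G.elAt v).gr) = ev (c'.γ v) (𝟙 _) :=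
      D.hom_cor v
    exact h1.symm.trans ((congrArg (F'.res (E := G.elAt v) u) h3).trans h2)
  · refine dec_ext (fun a => hk.2 a) (fun w => ?_)
    rw [D.hom_cor]
    exact congrArg (fun t => ev t (𝟙 (G.elAt w).gr)) (hk.1 w)

lemma mu_eta_right {n : Type} (X : DGraph n F) : (muFun (X.push (etaApp F))).cls = X.cls :=
  mu_eq (X.push (etaApp F)) (fun v => etaFun (X.G.finite_fl v) (ev X.γ (X.G.corAt v)))
    (fun _ => rfl) X (corCoc X.G (fun v => ev X.γ (X.G.corAt v))) (corCoc_isUniv X.G _)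
    (fun _ => rfl)
    (fun v => ev_ext fun _ u => (res_ev X.γ (E := X.G.elAt v) u (X.G.corAt v)).symm) (fun _ => rfl)

/-- Restricting representatives along an etale morphism. -/
lemma rep_pull {G X : Gr} (f : X ⟶ G) (δ : yo.obj G ⟶ bar F) (M : ∀ v, DGraph (G.Fl v) F)
    (hM : ∀ v, (M v).cls = ev δ (G.corAt v)) (w : X.V) :
    ((M (f.v w)).relabel (equivOf (atMap f w))).cls = ev (yo.map f ≫ δ) (X.corAt w) := by
  rw [ev_yo, ← atMap_comp, ← res_ev, ← hM]
  rfl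

/-- Substituting a substitution. Here `S` is a colimit of graphs `K v` along `G`, the graph `Z` is a
colimit of graphs `M y` along `S`, and the result is that `Z` is a colimit, along `G`, of the
colimits of the `M y` along the `K v`. -/
lemma subst_iterate {G : Gr} (K : ∀ v, DGraph (G.Fl v) (bar F)) {S : Gr}
    (c : Coc G (fun v => (K v).G) (fun v => (K v).port) (yo.obj S)) (hc : c.IsUniv)
    (q : ∀ v, (K v).G ⟶ S) (a : G.A → S.A)
    (hq : ∀ v, c.γ v = yo.map (q v)) (ha : ∀ x, c.d x = ⟨S.arc (a x)⟩)
    (hV : Function.Bijective (fun w : Σ v, (K v).G.V => (q w.1).v w.2))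
    (δ : yo.obj S ⟶ bar F) (hδ : ∀ v, yo.map (q v) ≫ δ = (K v).γ)
    (M : ∀ y, DGraph (S.Fl y) F) (hM : ∀ y, (M y).cls = ev δ (S.corAt y))
    {Z : Species} (cM : Coc S (fun y => (M y).G) (fun y => (M y).port) Z) (hcM : cM.IsUniv) :
    ∃ (P : ∀ v, DGraph (G.Fl v) F) (_ : ∀ v, (P v).cls = (muFun (K v)).cls)
      (c' : Coc G (fun v => (P v).G) (fun v => (P v).port) Z),
      c'.IsUniv ∧ (∀ x, c'.d x = cM.d (a x)) ∧
        ∀ θ : Z ⟶ F, (∀ y, cM.γ y ≫ θ = (M y).γ) →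
          (∀ x, θ.app _ (cM.d x) = ev δ (S.arc x)) → ∀ v, c'.γ v ≫ θ = (P v).γ := by
  have hL : ∀ v w, ((M ((q v).v w)).relabel (equivOf (atMap (q v) w))).cls =
      ev (K v).γ ((K v).G.corAt w) := fun v w => by
    rw [← hδ v]; exact rep_pull (q v) δ M hM w
  let P : ∀ v, DGraph (G.Fl v) F := fun v => subst (K v) _ (hL v)
  let N : ∀ y, NGraph (S.Fl y) := fun y => (M y).toNGraph
  let cP : ∀ v, Coc (K v).G (fun w => (pullN (q v) N w).G) (fun w => (pullN (q v) N w).port)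
      (yo.obj (P v).G) := fun v => glueCoc (K v).G (pullN (q v) N)
  have hcP : ∀ v, (cP v).IsUniv := fun v => glueCoc_isUniv (K v).G (pullN (q v) N)
  obtain ⟨c', h1, h2, h3, h4⟩ := Coc.iterate (fun v => (K v).toNGraph) q a c hc hq ha hV N cM hcM
    (fun v => (P v).G) (fun v => (P v).port) cP hcP (fun v h => rfl)
  refine ⟨P, fun v => (mu_subst (K v) _ (hL v)).symm, c', h1, h2, fun θ hθ hθ' v => ?_⟩
  refine Coc.ext_hom (hcP v) (fun w => ?_) (fun x => ?_)
  · refine (Category.assoc _ _ _).symm.trans ((congrArg (· ≫ θ) (h3 v w)).trans ((hθ _).trans ?_))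
    exact (glueDesc_q (cocOf (K v).γ _ (hL v)) w).symm
  · refine (congrArg (fun t => θ.app _ t) (h4 v x)).trans ((hθ' _).trans ?_)
    refine Eq.trans ?_ (glueDesc_d (cocOf (K v).γ _ (hL v)) x).symm
    change _ = ev (K v).γ ((K v).G.arc x)
    rw [← hδ, ev_yo, arc_comp]

lemma mu_assoc {n : Type} (X : DGraph n (bar (bar F))) :
    (muFun (X.push (muApp F))).cls = (muFun (muFun X)).cls := by
  let K := rep X.γ
  let c := glueCoc X.G (fun v => (K v).toNGraph)
  have hd := glueDesc_d (cocOf X.γ K (rep_cls X.γ))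
  have hq := glueDesc_q (cocOf X.γ K (rep_cls X.γ))
  let S := muFun X
  let M := rep S.γ
  have hV : Function.Bijective (fun w : Σ v, (K v).G.V =>
      (glueQ X.G (fun v => (K v).toNGraph) w.1).v w.2) := Function.bijective_id
  obtain ⟨P, hP, c', h1, h2, h3⟩ := subst_iterate K c (glueCoc_isUniv _ _)
    (glueQ X.G (fun v => (K v).toNGraph)) (fun x => .inl x) (fun _ => rfl) (fun _ => rfl) hV
    S.γ (fun v => hq v) M (rep_cls S.γ) (glueCoc S.G (fun y => (M y).toNGraph))
    (glueCoc_isUniv _ _)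
  have hd' := glueDesc_d (cocOf S.γ M (rep_cls S.γ))
  refine mu_eq (X.push (muApp F)) P (fun v => ?_) (muFun S) c' h1 (fun x => ?_)
    (h3 (muFun S).γ (fun y => glueDesc_q (cocOf S.γ M (rep_cls S.γ)) y) hd') (fun x => ?_)
  · refine (hP v).trans ?_
    exact congrArg (muVal F (X.G.elAt v)) (rep_cls X.γ v)
  · exact h2 _
  · exact (congrArg (fun t => (muFun S).γ.app _ t) (h2 x)).trans ((hd' _).trans (hd x))

/-- The monad on graphical species whose algebras are the compact coloured props. -/
def ccp : Monad Species where
  toFunctor := barFunctor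
  η :=
    { app := etaApp
      naturality := fun F F' θ => by
        ext E x
        induction E using Opposite.rec with | _ E
        match E, x with
        | .unit, x => rfl
        | .cor n hn, x =>
          refine DGraph.cls_eq.2 ⟨Iso.refl _, fun _ => rfl, ?_⟩
          refine ev_ext fun E t => ?_
          exact (app_res θ (show E ⟶ El.cor n hn from t) x) }
  μ :=
    { app := muApp
      naturality := fun F F' θ => by
        refine bar_ext (fun _ => rfl) fun n hn X => ?_
        change (muFun (X.push (barMap θ))).cls = ((muFun X).push θ).cls
        refine mu_eq (X.push (barMap θ)) (fun v => (rep X.γ v).push θ) (fun v => ?_)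
          ((muFun X).push θ) (glueCoc X.G (fun v => (rep X.γ v).toNGraph))
          (glueCoc_isUniv X.G (fun v => (rep X.γ v).toNGraph)) (fun _ => rfl)
          (fun v => ?_) (fun x => ?_)
        · exact congrArg (barApp θ (X.G.elAt v)) (rep_cls X.γ v)
        · exact congrArg (· ≫ θ) (glueDesc_q (cocOf X.γ (rep X.γ) (rep_cls X.γ)) v)
        · exact congrArg (fun t => θ.app _ t) (glueDesc_d (cocOf X.γ (rep X.γ) (rep_cls X.γ)) x) }
  left_unit F := by
    refine bar_ext (fun _ => rfl) fun n hn X => ?_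
    change (muFun (etaFun (F := bar F) hn X.cls)).cls = X.cls
    exact mu_eta_left hn X
  right_unit F := by
    refine bar_ext (fun _ => rfl) fun n hn X => ?_
    change (muFun (X.push (etaApp F))).cls = X.cls
    exact mu_eta_right X
  assoc F := by
    refine bar_ext (fun _ => rfl) fun n hn X => ?_
    change (muFun (X.push (muApp F))).cls = (muFun (muFun X)).cls
    exact mu_assoc X

end multiplication

/-- The restricted Kleisli category: the full subcategory of the Kleisli category of the monad
whose objects are the graphs without isolated edges. -/
abbrev KlGr := InducedCategory (Kleisli ccp)
  (fun R : {G : Gr // G.NoIsolatedEdges} => Kleisli.mk ccp (yo.obj R.1))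

/-- The morphism of species `R ⟶ bar Y` underlying a Kleisli morphism from `R` to `Y`. -/
def KlGr.toBar {R Y : KlGr} (φ : R ⟶ Y) :
    yo.obj (Subtype.val (p := Gr.NoIsolatedEdges) R) ⟶
      bar (yo.obj (Subtype.val (p := Gr.NoIsolatedEdges) Y)) := φ.hom.of

/-- A Kleisli morphism `R ⟶ bar Y` assigns to each vertex of `R` a graph etale over `Y`; the colimit
of these graphs, glued as `R` is glued from its corollas. -/
abbrev colimGraph {R Y : Gr} (φ : yo.obj R ⟶ bar (yo.obj Y)) : Gr :=
  glue R (fun v => (rep φ v).toNGraph)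

/-- The canonical etale morphism from the colimit to `Y`. -/
def colimMap {R Y : Gr} (φ : yo.obj R ⟶ bar (yo.obj Y)) : colimGraph φ ⟶ Y :=
  unyo (glueDesc (cocOf φ (rep φ) (rep_cls φ)))

/-- A Kleisli morphism from `R` to `Y` is generic if the etale morphism to `Y` from the colimit
graph is invertible. -/
def generic : MorphismProperty KlGr := fun _ _ φ => IsIso (colimMap (KlGr.toBar φ))

section generic

lemma Coc.isUniv_congr {G : Gr} {K : G.V → Gr} {b : ∀ v, G.Fl v → (K v).A} {S : Species}
    {c c' : Coc G K b S} (hc : c.IsUniv) (h1 : ∀ v, c.γ v = c'.γ v) (h2 : ∀ x, c.d x = c'.d x) :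
    c'.IsUniv := by
  have : c = c' := by
    cases c; cases c'
    obtain rfl := funext h1
    obtain rfl := funext h2
    rfl
  exact this ▸ hc

lemma Coc.push_isUniv {G : Gr} {K : G.V → Gr} {b : ∀ v, G.Fl v → (K v).A} {S S' : Species}
    {c : Coc G K b S} (hc : c.IsUniv) (e : S ≅ S') : (c.push e.hom).IsUniv := by
  intro F c'
  obtain ⟨k, ⟨k1, k2⟩, k3⟩ := hc F c'
  have hd : ∀ y, e.inv.app (.op .unit) (e.hom.app _ y) = y := fun y =>
    ConcreteCategory.congr_hom (NatTrans.congr_app e.hom_inv_id (.op El.unit)) y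
  refine ⟨e.inv ≫ k, ⟨fun v => ?_, fun x => ?_⟩, fun l hl => ?_⟩
  · change (c.γ v ≫ e.hom) ≫ e.inv ≫ k = _
    simp [k1]
  · change k.app _ (e.inv.app _ (e.hom.app _ (c.d x))) = _
    rw [hd, k2]
  · rw [← k3 (e.hom ≫ l) ⟨fun v => ?_, fun x => hl.2 x⟩]
    · simp
    · rw [← hl.1 v]
      exact (Category.assoc _ _ _).symm

variable {R Y Z : Gr} (φ : yo.obj R ⟶ bar (yo.obj Y))

/-- Genericity can be computed with any choice of representatives: the given graphs etale over `Y`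
have `Y` as their colimit. -/
lemma isIso_colimMap_iff (K : ∀ v, DGraph (R.Fl v) (yo.obj Y))
    (hK : ∀ v, (K v).cls = ev φ (R.corAt v)) :
    IsIso (colimMap φ) ↔ (cocOf φ K hK).IsUniv := by
  have hr : ∀ v, DGraph.Rel (rep φ v) (K v) := fun v =>
    DGraph.cls_eq.1 ((rep_cls φ v).trans (hK v).symm)
  have hr' : ∀ v, DGraph.Rel (K v) (rep φ v) := fun v =>
    DGraph.cls_eq.1 ((hK v).trans (rep_cls φ v).symm)
  have h1 : IsIso (colimMap φ) ↔ (cocOf φ (rep φ) (rep_cls φ)).IsUniv := by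
    have hq := glueDesc_q (cocOf φ (rep φ) (rep_cls φ))
    have hd := glueDesc_d (cocOf φ (rep φ) (rep_cls φ))
    have hu := glueCoc_isUniv R (fun v => (rep φ v).toNGraph)
    constructor
    · intro h
      refine Coc.isUniv_congr (Coc.push_isUniv hu (yo.mapIso (@asIso _ _ _ _ (colimMap φ) h))) ?_ ?_
      · intro v
        refine Eq.trans ?_ (hq v)
        change _ ≫ yo.map (colimMap φ) = _
        rw [colimMap, yo_unyo]
        rfl
      · intro x
        refine Eq.trans ?_ (hd x)
        change (yo.map (colimMap φ)).app _ _ = _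
        rw [colimMap, yo_unyo]
        rfl
    · intro h
      obtain ⟨e, e1, e2⟩ := Coc.uniq hu h
      have : colimMap φ = e.hom := by
        refine yo_injective ?_
        rw [colimMap, yo_unyo]
        exact Coc.ext_hom hu (fun v => (hq v).trans (e1 v).symm) (fun x => (hd x).trans (e2 x).symm)
      exact this ▸ e.isIso_hom
  rw [h1]
  constructor
  · intro h
    choose f hf hfγ using hr'
    exact Coc.isUniv_congr (Coc.reidx_isUniv (b' := fun v => (K v).port) f hf h) hfγ (fun _ => rfl)
  · intro h
    choose f hf hfγ using hr
    exact Coc.isUniv_congr (Coc.reidx_isUniv (b' := fun v => (rep φ v).port) f hf h) hfγ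
      (fun _ => rfl)

lemma isIso_colimMap_eta : IsIso (colimMap (etaApp (yo.obj R))) := by
  let y : ∀ v, (yo.obj R).obj (.op (R.elAt v)) := fun v => ULift.up (R.corAt v)
  rw [isIso_colimMap_iff _ (fun v => etaFun (R.finite_fl v) (y v)) (fun v => rfl)]
  exact Coc.isUniv_congr (corCoc_isUniv R y) (fun v => rfl) (fun x => rfl)

lemma isIso_colimMap_comp (ψ : yo.obj Y ⟶ bar (yo.obj Z)) (hφ : IsIso (colimMap φ))
    (hψ : IsIso (colimMap ψ)) : IsIso (colimMap (φ ≫ barMap ψ ≫ muApp (yo.obj Z))) := by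
  have hc := (isIso_colimMap_iff φ (rep φ) (rep_cls φ)).1 hφ
  have hcM := (isIso_colimMap_iff ψ (rep ψ) (rep_cls ψ)).1 hψ
  let q : ∀ v, (rep φ v).G ⟶ Y := fun v => unyo (rep φ v).γ
  have hq : ∀ v, yo.map (q v) = (rep φ v).γ := fun v => yo_unyo _
  have hqe : ∀ v, glueQ R (fun v => (rep φ v).toNGraph) v ≫ colimMap φ = q v := by
    intro v
    refine yo_injective ?_
    rw [hq, yo.map_comp, colimMap, yo_unyo]
    exact glueDesc_q (cocOf φ (rep φ) (rep_cls φ)) v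
  have hV : Function.Bijective (fun w : Σ v, (rep φ v).G.V => (q w.1).v w.2) := by
    have h0 : (fun w : Σ v, (rep φ v).G.V => (q w.1).v w.2) = (colimMap φ).v := by
      funext w
      rw [← hqe]; rfl
    rw [h0]
    refine Function.bijective_iff_has_inverse.2 ⟨(inv (colimMap φ)).v, fun w => ?_, fun w => ?_⟩
    · exact congrArg (fun t : colimGraph φ ⟶ colimGraph φ => t.v w)
        (IsIso.hom_inv_id (colimMap φ))
    · exact congrArg (fun t : Y ⟶ Y => t.v w) (IsIso.inv_hom_id (colimMap φ))
  obtain ⟨P, hP, c', h1, h2, h3⟩ := subst_iterate (fun v => (rep φ v).push ψ)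
    (cocOf φ (rep φ) (rep_cls φ)) hc q (fun x => (ev φ (R.arc x)).down.a true)
    (fun v => (hq v).symm) (fun x => congrArg ULift.up (eq_arc _)) hV ψ
    (fun v => congrArg (· ≫ ψ) (hq v)) (rep ψ) (rep_cls ψ) _ hcM
  rw [isIso_colimMap_iff _ P (fun v => ?_)]
  · refine Coc.isUniv_congr h1 (fun v => ?_) (fun x => ?_)
    · rw [← Category.comp_id (c'.γ v)]
      exact h3 (𝟙 _) (fun y => Category.comp_id _) (fun x => rfl) v
    · rw [h2]
      change ev ψ (Y.arc ((ev φ (R.arc x)).down.a true)) = ψ.app _ (ev φ (R.arc x))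
      rw [← eq_arc]
      rfl
  · refine (hP v).trans ?_
    exact congrArg (fun t => muVal (yo.obj Z) (R.elAt v) (barApp ψ (R.elAt v) t)) (rep_cls φ v)

instance : generic.IsMultiplicative where
  id_mem R := isIso_colimMap_eta (R := Subtype.val (p := Gr.NoIsolatedEdges) R)
  comp_mem f g hf hg := isIso_colimMap_comp (KlGr.toBar f) (KlGr.toBar g) hf hg

end generic

/-! The category of Borisov and Manin. -/

/-- A (finite) graph in the sense of Kontsevich and Manin: a set `V` of vertices, a set `F` of
flags, a map `bd : F → V` and an involution `j` of `F`. -/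
structure BMGraph where
  V : Type
  F : Type
  finV : Finite V
  finF : Finite F
  bd : F → V
  j : F → F
  j_j : ∀ f, j (j f) = f

namespace BMGraph

/-- The tails are the fixpoints of the involution. -/
def tails (τ : BMGraph) : Set τ.F := {f | τ.j f = f}

/-- Morphisms `(h^F, h_V, j_h)` of graphs. The fixpoint-free involution `j_h` on the complement of
the image of `h^F` is extended to all flags by letting it fix the image of `h^F` pointwise. -/
@[ext]
structure Hom (τ σ : BMGraph) where
  hF : σ.F → τ.F
  hV : τ.V → σ.V
  jh : τ.F → τ.F
  hF_inj : Function.Injective hF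
  hV_surj : Function.Surjective hV
  /-- The image of `h^F` (and hence its complement) is invariant. -/
  j_mem : ∀ f, τ.j (hF f) ∈ Set.range hF
  jh_jh : ∀ f, jh (jh f) = f
  jh_fix : ∀ f, jh f = f ↔ f ∈ Set.range hF
  /-- On contracted flags, `j_h` agrees with `j_τ` on edges. -/
  jh_edge : ∀ f, f ∉ Set.range hF → τ.j f ≠ f → jh f = τ.j f
  bd_hF : ∀ f, hV (τ.bd (hF f)) = σ.bd f
  /-- The two vertices of a contracted edge, actual or virtual, have the same image. -/
  bd_jh : ∀ f, f ∉ Set.range hF → hV (τ.bd (jh f)) = hV (τ.bd f)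
  /-- Edges of `τ` in the image of `h^F` come from edges of `σ`. -/
  edge : ∀ f, τ.j (hF f) ≠ hF f → hF (σ.j f) = τ.j (hF f)

open Classical in
/-- The involution of a composite: `j_g` on the complement of `g^F`, and `j_c` on the complement
of `c^F`, the latter viewed as a subset of the image of `g^F`. -/
def compJ {τ σ ρ : BMGraph} (g : Hom τ σ) (c : Hom σ ρ) (f : τ.F) : τ.F :=
  if h : f ∈ Set.range g.hF then g.hF (c.jh h.choose) else g.jh f

lemma compJ_hF {τ σ ρ : BMGraph} (g : Hom τ σ) (c : Hom σ ρ) (x : σ.F) :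
    compJ g c (g.hF x) = g.hF (c.jh x) := by
  have h : g.hF x ∈ Set.range g.hF := ⟨x, rfl⟩
  rw [compJ, dif_pos h, g.hF_inj h.choose_spec]

lemma compJ_not {τ σ ρ : BMGraph} (g : Hom τ σ) (c : Hom σ ρ) {f : τ.F}
    (h : f ∉ Set.range g.hF) : compJ g c f = g.jh f := by
  rw [compJ, dif_neg h]

lemma Hom.jh_not {τ σ : BMGraph} (g : Hom τ σ) {f : τ.F} (h : f ∉ Set.range g.hF) :
    g.jh f ∉ Set.range g.hF := by
  intro h'
  have h1 := (g.jh_fix (g.jh f)).2 h'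
  rw [g.jh_jh] at h1
  exact h ((g.jh_fix f).1 h1.symm)

/-- The composite of two morphisms of graphs. -/
def Hom.comp {τ σ ρ : BMGraph} (g : Hom τ σ) (c : Hom σ ρ) : Hom τ ρ where
  hF := g.hF ∘ c.hF
  hV := c.hV ∘ g.hV
  jh := compJ g c
  hF_inj := g.hF_inj.comp c.hF_inj
  hV_surj := c.hV_surj.comp g.hV_surj
  j_mem f := by
    by_cases h : τ.j (g.hF (c.hF f)) = g.hF (c.hF f)
    · exact ⟨f, h.symm⟩
    · obtain ⟨y, hy⟩ := c.j_mem f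
      refine ⟨y, ?_⟩
      change g.hF (c.hF y) = τ.j (g.hF (c.hF f))
      rw [hy, g.edge _ h]
  jh_jh f := by
    by_cases h : f ∈ Set.range g.hF
    · obtain ⟨x, rfl⟩ := h
      rw [compJ_hF, compJ_hF, c.jh_jh]
    · rw [compJ_not g c h, compJ_not g c (g.jh_not h), g.jh_jh]
  jh_fix f := by
    by_cases h : f ∈ Set.range g.hF
    · obtain ⟨x, rfl⟩ := h
      rw [compJ_hF, g.hF_inj.eq_iff, c.jh_fix, Set.range_comp, g.hF_inj.mem_set_image]
    · rw [compJ_not g c h, g.jh_fix]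
      exact ⟨fun h' => (h h').elim, fun ⟨y, hy⟩ => (h ⟨c.hF y, hy⟩).elim⟩
  jh_edge f hf hj := by
    by_cases h : f ∈ Set.range g.hF
    · obtain ⟨x, rfl⟩ := h
      rw [compJ_hF, ← g.edge x hj]
      rw [← g.edge x hj] at hj
      rw [c.jh_edge x (fun ⟨y, hy⟩ => hf ⟨y, by rw [← hy]; rfl⟩) (fun h' => hj (by rw [h']))]
    · rw [compJ_not g c h, g.jh_edge f h hj]
  bd_hF f := by
    change c.hV (g.hV (τ.bd (g.hF (c.hF f)))) = _
    rw [g.bd_hF, c.bd_hF]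
  bd_jh f hf := by
    change c.hV (g.hV _) = c.hV (g.hV _)
    by_cases h : f ∈ Set.range g.hF
    · obtain ⟨x, rfl⟩ := h
      rw [compJ_hF, g.bd_hF, g.bd_hF]
      exact c.bd_jh x (fun ⟨y, hy⟩ => hf ⟨y, by rw [← hy]; rfl⟩)
    · rw [compJ_not g c h, g.bd_jh f h]
  edge f hf := by
    change g.hF (c.hF (ρ.j f)) = τ.j (g.hF (c.hF f))
    have h1 : g.hF (σ.j (c.hF f)) = τ.j (g.hF (c.hF f)) := g.edge _ hf
    have h2 : σ.j (c.hF f) ≠ c.hF f := fun h => hf (by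
      change τ.j (g.hF (c.hF f)) = g.hF (c.hF f)
      rw [← h1, h])
    rw [c.edge f h2, h1]

/-- The category of graphs of Borisov and Manin. -/
instance : Category BMGraph where
  Hom := Hom
  id τ :=
    { hF := id, hV := id, jh := id
      hF_inj := Function.injective_id
      hV_surj := Function.surjective_id
      j_mem := by simp
      jh_jh := by simp
      jh_fix := by simp
      jh_edge := by simp
      bd_hF := by simp
      bd_jh := by simp
      edge := by simp }
  comp g c := g.comp c
  id_comp {τ σ} h := by
    refine Hom.ext rfl rfl (funext fun f => ?_)
    exact compJ_hF (σ := τ) _ h f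
  comp_id {τ σ} h := by
    refine Hom.ext rfl rfl (funext fun f => ?_)
    change compJ h _ f = h.jh f
    by_cases hf : f ∈ Set.range h.hF
    · rw [(h.jh_fix f).2 hf]
      obtain ⟨x, rfl⟩ := hf
      exact compJ_hF h _ x
    · exact compJ_not h _ hf
  assoc {τ σ ρ π} f g h := by
    refine Hom.ext rfl rfl (funext fun x => ?_)
    change compJ (Hom.comp f g) h x = compJ f (Hom.comp g h) x
    by_cases hx : x ∈ Set.range f.hF
    · obtain ⟨x, rfl⟩ := hx
      rw [compJ_hF]
      change _ = f.hF (compJ g h x)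
      by_cases hy : x ∈ Set.range g.hF
      · obtain ⟨x, rfl⟩ := hy
        rw [compJ_hF]
        exact compJ_hF (Hom.comp f g) h x
      · rw [compJ_not g h hy, compJ_not (Hom.comp f g) h]
        · exact compJ_hF f g x
        · rintro ⟨y, hy'⟩
          exact hy ⟨y, f.hF_inj hy'⟩
    · rw [compJ_not f _ hx, compJ_not (Hom.comp f g) h]
      · exact compJ_not f g hx
      · rintro ⟨y, hy⟩
        exact hx ⟨g.hF y, hy⟩

/-- A morphism `h` is a compression if `h^F` is bijective on tails. -/
def compression : MorphismProperty BMGraph :=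
  fun τ σ h => Set.BijOn (Hom.hF h) σ.tails τ.tails

instance : compression.IsMultiplicative where
  id_mem τ := Set.bijOn_id τ.tails
  comp_mem {_ _ _} g c hg hc := Set.BijOn.comp (g := Hom.hF g) (f := Hom.hF c) hg hc

open Classical in
/-- The involution on the arcs of the Joyal-Kock graph associated with a graph. -/
def arcInv (τ : BMGraph) : τ.F ⊕ τ.tails → τ.F ⊕ τ.tails
  | .inl f => if h : τ.j f = f then .inr ⟨f, h⟩ else .inl (τ.j f)
  | .inr t => .inl t.1

/-- The Joyal-Kock graph associated with a graph: same vertices, the flags as half-edges, and as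
arcs the flags and a second copy of each tail, which is a port. The involution interchanges the
flags of an edge, and interchanges a tail with its copy. -/
def toGr (τ : BMGraph) : Gr where
  A := τ.F ⊕ τ.tails
  H := τ.F
  V := τ.V
  finA := by
    have := τ.finF
    infer_instance
  finH := τ.finF
  finV := τ.finV
  i := τ.arcInv
  s := .inl
  p := τ.bd
  i_i := by
    rintro (f | t)
    · by_cases h : τ.j f = f
      · simp [arcInv, h]
      · simp [arcInv, h, τ.j_j]
        exact fun e => (h e.symm).elim
    · have : τ.j t.1 = t.1 := t.2
      simp [arcInv, this]
  i_ne := by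
    rintro (f | t)
    · by_cases h : τ.j f = f
      · simp [arcInv, h]
      · simp [arcInv, h]
    · simp [arcInv]
  s_inj := Sum.inl_injective

lemma toGr_noIsolatedEdges (τ : BMGraph) : τ.toGr.NoIsolatedEdges := by
  rintro (f | t) ⟨h1, h2⟩
  · exact h1 ⟨f, rfl⟩
  · exact h2 ⟨t.1, rfl⟩

/-- The Joyal-Kock graph associated with a graph, as an object of the restricted Kleisli
category. -/
def toKl (τ : BMGraph) : KlGr := (⟨τ.toGr, τ.toGr_noIsolatedEdges⟩ : {G : Gr // G.NoIsolatedEdges})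

end BMGraph

/-- The Kleisli morphism `φ : ρ ⟶ σ` is the refinement which is opposite to `h : σ ⟶ ρ`: on arcs, it
is given by `h^F` (sending the arc of a flag `f` to the arc of the flag `h^F f`), and the graph
etale over `σ` which it assigns to a vertex `x` of `ρ` has as vertices the `h_V`-preimage of `x`. -/
def IsOpposite {σ ρ : BMGraph} (h : σ ⟶ ρ) (φ : ρ.toKl ⟶ σ.toKl) : Prop :=
  (∀ f : ρ.F, ev (KlGr.toBar φ) (ρ.toGr.arc (.inl f)) =
      (⟨σ.toGr.arc (.inl (BMGraph.Hom.hF h f))⟩ : (yo.obj σ.toGr).obj (.op .unit))) ∧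
    ∀ (x : ρ.V) (X : DGraph (ρ.toGr.Fl x) (yo.obj σ.toGr)) (q : X.G ⟶ σ.toGr),
      X.cls = ev (KlGr.toBar φ) (ρ.toGr.corAt x) → X.γ = yo.map q →
        Set.range q.v = BMGraph.Hom.hV h ⁻¹' {x}

end

open CategoryTheory

noncomputable section

open Gr

/-! ### Etale morphisms between graphs without isolated edges -/

namespace Gr

variable {X Y : Gr}

/-! A compression `h : σ ⟶ ρ` matches the tails of `ρ` with those of `σ`. Hence every tail of `σ`
lies in the image of `h^F`, the flags outside that image lie on actual edges, `j_h` is forced, and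
`h^F` commutes with the involutions. What remains is a decomposition of `σ`. For each vertex `x` of
`ρ` take the vertices in `h_V⁻¹(x)`, keep the contracted edges between them, and cut all other edges
open. This gives a nonempty graph without isolated edges whose ports are labelled by the flags at
`x`, and gluing these fibres along `ρ` gives back `σ`. A generic morphism is exactly such a
decomposition: graphs etale over `σ`, indexed by the vertices of `ρ`, whose gluing is `σ`.

The Kleisli side consists of isomorphism classes, so the two sides are compared through the relation
`IsOpposite`. Every compression has a generic opposite (`oppHom_generic`, `isOpposite_oppHom`),
every generic morphism is opposite to a compression (`exists_compression`), and among compressions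
and generic morphisms each determines the other (`IsOpposite.unique`, `IsOpposite.unique_left`).
Since the relation contains identities and is stable under composition (`isOpposite_id`,
`IsOpposite.comp`), uniqueness makes the assignment a functor, and it is full and faithful.
Essential surjectivity is `isIso_ofGrMap`: a graph without isolated edges is recovered from its
flags and the pairing of those on inner edges.

Two facts about etale morphisms carry the argument. By `isIso_of_ports`, between graphs without
isolated edges, a morphism that is bijective on vertices and sends ports to ports is invertible;
this recognizes the gluing of the fibres as `σ`. By `DGraph.rel_of_range_eq`, an effective graph
over `Y` which is injective on vertices is determined, up to isomorphism over `Y`, by its vertices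
and labelled ports in `Y`; this turns the vertex condition in `IsOpposite` into equality of
isomorphism classes. -/

lemma Hom.h_injective_of_v_injective (f : X ⟶ Y) (hv : Function.Injective f.v) :
    Function.Injective f.h := by
  intro x y hxy
  have hp : X.p x = X.p y := hv (by rw [f.v_p, f.v_p, hxy])
  exact (f.cart (X.p y) (f.h y) (f.v_p y).symm).unique ⟨hp, hxy⟩ ⟨rfl, rfl⟩

/-- The map on flags is a pullback of the map on vertices, and bijections are stable under pullback.
-/
lemma Hom.h_bijective_of_v_bijective (f : X ⟶ Y) (hv : Function.Bijective f.v) :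
    Function.Bijective f.h := by
  refine ⟨f.h_injective_of_v_injective hv.1, fun k => ?_⟩
  obtain ⟨w, hw⟩ := hv.2 (Y.p k)
  obtain ⟨x, hx, -⟩ := f.cart w k hw.symm
  exact ⟨x, hx.2⟩

lemma NoIsolatedEdges.eq_s_or (hX : X.NoIsolatedEdges) (a : X.A) :
    (∃ x, a = X.s x) ∨ ∃ x, a = X.i (X.s x) := by
  by_cases h : X.IsPort a
  · obtain ⟨x, hx⟩ := not_not.1 fun h' => hX a ⟨h, h'⟩
    exact .inr ⟨x, by rw [hx, X.i_i]⟩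
  · obtain ⟨x, hx⟩ := not_not.1 h
    exact .inl ⟨x, hx.symm⟩

/-- Every arc is the arc of a flag or its reverse, so the action on arcs is forced by that on flags.
-/
lemma NoIsolatedEdges.hom_ext (hX : X.NoIsolatedEdges) {f g : X ⟶ Y}
    (hh : ∀ x, f.h x = g.h x) (hv : ∀ x, f.v x = g.v x) : f = g := by
  have hs : ∀ x, f.a (X.s x) = g.a (X.s x) := fun x => by rw [f.a_s, g.a_s, hh]
  refine Gr.hom_ext (fun a => ?_) hh hv
  obtain ⟨x, rfl⟩ | ⟨x, rfl⟩ := hX.eq_s_or a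
  · exact hs x
  · rw [f.a_i, g.a_i, hs]

lemma isIso_of_bijective (f : X ⟶ Y) (ha : Function.Bijective f.a) (hv : Function.Bijective f.v) :
    IsIso f := by
  let ea := Equiv.ofBijective _ ha
  let ev := Equiv.ofBijective _ hv
  let eh := Equiv.ofBijective _ (f.h_bijective_of_v_bijective hv)
  have hea : ∀ x, f.a (ea.symm x) = x := ea.apply_symm_apply
  have hev : ∀ x, f.v (ev.symm x) = x := ev.apply_symm_apply
  have heh : ∀ x, f.h (eh.symm x) = x := eh.apply_symm_apply
  let g : Y ⟶ X :=
    { a := ea.symm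
      h := eh.symm
      v := ev.symm
      a_i := fun x => ha.1 (by rw [f.a_i, hea, hea])
      a_s := fun x => ha.1 (by rw [f.a_s, hea, heh])
      v_p := fun x => hv.1 (by rw [f.v_p, hev, heh])
      cart := fun w k hk => by
        refine ⟨f.h k, ⟨?_, eh.symm_apply_apply k⟩, fun y hy => ?_⟩
        · rw [← f.v_p, hk, hev]
        · rw [← hy.2, heh] }
  exact ⟨g, Gr.hom_ext ea.symm_apply_apply eh.symm_apply_apply ev.symm_apply_apply,
    Gr.hom_ext hea heh hev⟩

lemma a_bijective_of_isIso (f : X ⟶ Y) [IsIso f] : Function.Bijective f.a :=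
  Function.bijective_iff_has_inverse.2 ⟨(inv f).a,
    fun w => congrArg (fun t : X ⟶ X => t.a w) (IsIso.hom_inv_id f),
    fun w => congrArg (fun t : Y ⟶ Y => t.a w) (IsIso.inv_hom_id f)⟩

lemma v_bijective_of_isIso (f : X ⟶ Y) [IsIso f] : Function.Bijective f.v :=
  Function.bijective_iff_has_inverse.2 ⟨(inv f).v,
    fun w => congrArg (fun t : X ⟶ X => t.v w) (IsIso.hom_inv_id f),
    fun w => congrArg (fun t : Y ⟶ Y => t.v w) (IsIso.inv_hom_id f)⟩

/-- Arcs that are not ports correspond to flags, and on flags bijectivity is inherited from the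
vertices. The only possible failure is that ports of `X` are joined to flags to form inner edges of
`Y`, which `hp` excludes. -/
lemma isIso_of_ports (hX : X.NoIsolatedEdges) (hY : Y.NoIsolatedEdges) (f : X ⟶ Y)
    (hv : Function.Bijective f.v) (hp : ∀ a, X.IsPort a → Y.IsPort (f.a a)) : IsIso f := by
  have hh := f.h_bijective_of_v_bijective hv
  -- An arc with the same image as the arc of a flag is not a port, since ports go to ports; hence
  -- it comes from a flag, and flags map injectively.
  have key : ∀ x b, f.a (X.s x) = f.a b → X.s x = b := by
    intro x b e
    by_cases hb : X.IsPort b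
    · exact (hp b hb ⟨f.h x, by rw [← e, f.a_s]⟩).elim
    · obtain ⟨y, rfl⟩ := not_not.1 hb
      rw [f.a_s, f.a_s] at e
      rw [hh.1 (Y.s_inj e)]
  refine isIso_of_bijective f ⟨fun a b e => ?_, fun y => ?_⟩ hv
  · obtain ⟨x, rfl⟩ | ⟨x, rfl⟩ := hX.eq_s_or a
    · exact key x b e
    · rw [key x (X.i b) (by rw [f.a_i, ← e, f.a_i, Y.i_i]), X.i_i]
  · obtain ⟨k, rfl⟩ | ⟨k, rfl⟩ := hY.eq_s_or y
    · obtain ⟨x, rfl⟩ := hh.2 k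
      exact ⟨X.s x, f.a_s x⟩
    · obtain ⟨x, rfl⟩ := hh.2 k
      exact ⟨X.i (X.s x), by rw [f.a_i, f.a_s]⟩

lemma isPort_of_isIso (f : X ⟶ Y) [IsIso f] {a : X.A} (ha : X.IsPort a) : Y.IsPort (f.a a) := by
  rintro ⟨k, hk⟩
  refine ha ⟨(inv f).h k, ?_⟩
  rw [← (inv f).a_s, hk, ← comp_a, IsIso.hom_inv_id, id_a]

end Gr

/-! ### Rigidity of labelled graphs embedded on vertices -/

section comparison

variable {n : Type} {Y : Gr}

lemma NGraph.port_isPort (X : NGraph n) (x : n) : X.G.IsPort (X.port x) := (X.β x).2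

lemma NGraph.exists_port {X : NGraph n} {a : X.G.A} (h : X.G.IsPort a) : ∃ x, X.port x = a :=
  ⟨X.β.symm ⟨a, h⟩, by simp [NGraph.port]⟩

lemma NGraph.exists_i_port (X : NGraph n) (x : n) : ∃ k, X.G.s k = X.G.i (X.port x) :=
  not_not.1 (X.not_port_i x)

/-- The map on vertices is forced by injectivity of `q'.v`, the map on flags by the pullback
property of `q'`, and the map on ports by the labels. The point to check is compatibility with the
involutions: the two graphs must cut the same edges of `Y`, and this is guaranteed by the common
images of the ports. -/
lemma NGraph.exists_hom {X X' : NGraph n} (q : X.G ⟶ Y) (q' : X'.G ⟶ Y)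
    (hq : Function.Injective q.v) (hq' : Function.Injective q'.v)
    (hr : Set.range q.v = Set.range q'.v) (hp : ∀ x, q.a (X.port x) = q'.a (X'.port x)) :
    ∃ e : X.G ⟶ X'.G, (∀ x, e.a (X.port x) = X'.port x) ∧ e ≫ q' = q := by
  have hv : ∀ w, ∃ w', q'.v w' = q.v w := fun w => by
    have : q.v w ∈ Set.range q'.v := hr ▸ ⟨w, rfl⟩
    exact this
  choose ev hev using hv
  have hh : ∀ k, ∃ k', X'.G.p k' = ev (X.G.p k) ∧ q'.h k' = q.h k := fun k =>
    (q'.cart (ev (X.G.p k)) (q.h k) (by rw [hev, q.v_p])).exists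
  choose eh ehp ehq using hh
  have qh := q.h_injective_of_v_injective hq
  have qh' := q'.h_injective_of_v_injective hq'
  -- The flags opposite to the ports labelled `x` in the two graphs have the same image in `Y`, and
  -- `q'` is injective on flags.
  have hport : ∀ k x, X.G.s k = X.G.i (X.port x) → X'.G.s (eh k) = X'.G.i (X'.port x) := by
    intro k x hk
    obtain ⟨k', hk'⟩ := X'.exists_i_port x
    rw [← hk']
    refine congrArg _ (qh' (Y.s_inj ?_))
    rw [ehq, ← q.a_s, ← q'.a_s, hk, hk', q.a_i, q'.a_i, hp]
  -- An inner edge of `X` is not cut in `X'`: if the reverse of the image of `l` were the port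
  -- labelled `x`, then the flag of `X` opposite to its own port `x` would be `l`, so the arc of `k`
  -- would be a port.
  have hinner : ∀ k l, X.G.s k = X.G.i (X.G.s l) → X'.G.s (eh k) = X'.G.i (X'.G.s (eh l)) := by
    intro k l hkl
    by_cases hl : X'.G.IsPort (X'.G.i (X'.G.s (eh l)))
    · obtain ⟨x, hx⟩ := NGraph.exists_port hl
      obtain ⟨m, hm⟩ := X.exists_i_port x
      have h1 := hport m x hm
      rw [hx, X'.G.i_i] at h1
      have h2 : m = l := qh (by rw [← ehq, ← ehq, X'.G.s_inj h1])
      rw [h2] at hm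
      rw [hm, X.G.i_i] at hkl
      exact (X.port_isPort x ⟨k, hkl⟩).elim
    · obtain ⟨m, hm⟩ := not_not.1 hl
      rw [← hm]
      refine congrArg _ (qh' (Y.s_inj ?_))
      rw [ehq, ← q.a_s, ← q'.a_s, hkl, hm, q.a_i, q'.a_i, q.a_s, q'.a_s, ehq]
  classical
  let ea : X.G.A → X'.G.A := fun a =>
    if h : X.G.IsPort a then X'.port (X.β.symm ⟨a, h⟩) else X'.G.s (eh (not_not.1 h).choose)
  have eap : ∀ x, ea (X.port x) = X'.port x := fun x => by
    have h := X.port_isPort x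
    simp only [ea, dif_pos h]
    congr 1
    exact X.β.symm_apply_apply x
  have eas : ∀ k, ea (X.G.s k) = X'.G.s (eh k) := fun k => by
    have h := X.G.not_port_s k
    simp only [ea, dif_neg h]
    have h2 := (not_not.1 h).choose_spec
    rw [X.G.s_inj h2]
  let e : X.G ⟶ X'.G :=
    { a := ea
      h := eh
      v := ev
      a_i := by
        intro a
        obtain ⟨x, rfl⟩ | ⟨x, rfl⟩ | ⟨⟨_, h1, h2⟩, rfl⟩ := X.arc_cases a
        · obtain ⟨k, hk⟩ := X.exists_i_port x
          rw [eap, ← hk, eas, hport k x hk]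
        · obtain ⟨k, hk⟩ := X.exists_i_port x
          rw [X.G.i_i, eap, ← hk, eas, hport k x hk, X'.G.i_i]
        · obtain ⟨k, rfl⟩ := not_not.1 h1
          obtain ⟨l, hl⟩ := not_not.1 h2
          rw [← hl, eas, eas, hinner l k hl]
      a_s := eas
      v_p := fun k => (ehp k).symm
      cart := fun w k hk => by
        obtain ⟨x, ⟨h1, h2⟩, -⟩ := q.cart w (q'.h k) (by rw [← q'.v_p, hk, hev])
        exact ⟨x, ⟨h1, qh' (by rw [ehq, h2])⟩, fun y hy => qh (by rw [← ehq, hy.2, h2])⟩ }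
  exact ⟨e, eap, X.eff.2.hom_ext ehq hev⟩

/-- Injectivity on vertices makes `q` injective on flags too, and these determine a morphism out of
an effective graph. This shows that the comparison morphisms in the two directions are mutually
inverse. -/
lemma NGraph.endo_eq_id {X : NGraph n} (q : X.G ⟶ Y) (hq : Function.Injective q.v)
    {e : X.G ⟶ X.G} (he : e ≫ q = q) : e = 𝟙 _ :=
  X.eff.2.hom_ext
    (fun x => q.h_injective_of_v_injective hq (congrArg (fun t : X.G ⟶ Y => t.h x) he))
    (fun x => hq (congrArg (fun t : X.G ⟶ Y => t.v x) he))

/-- A graph with labelled ports which embeds, on vertices, into `Y` is determined by its set of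
vertices and its ports in `Y`. -/
lemma DGraph.rel_of_range_eq {X X' : NGraph n} (q : X.G ⟶ Y) (q' : X'.G ⟶ Y)
    (hq : Function.Injective q.v) (hq' : Function.Injective q'.v)
    (hr : Set.range q.v = Set.range q'.v) (hp : ∀ x, q.a (X.port x) = q'.a (X'.port x)) :
    DGraph.Rel (⟨X, yo.map q⟩ : DGraph n (yo.obj Y)) ⟨X', yo.map q'⟩ := by
  obtain ⟨e, h1, h2⟩ := NGraph.exists_hom q q' hq hq' hr hp
  obtain ⟨e', h1', h2'⟩ := NGraph.exists_hom q' q hq' hq hr.symm (fun x => (hp x).symm)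
  refine ⟨⟨e, e', NGraph.endo_eq_id q hq ?_, NGraph.endo_eq_id q' hq' ?_⟩, h1, ?_⟩
  · rw [Category.assoc, h2', h2]
  · rw [Category.assoc, h2, h2']
  · exact (yo.map_comp _ _).symm.trans (congrArg yo.map h2)

/-- An isomorphism over `Y` does not change the image. Thus the vertex condition in `IsOpposite`
depends only on the isomorphism class. -/
lemma DGraph.range_v_eq {X X' : DGraph n (yo.obj Y)} (h : X.cls = X'.cls) {q : X.G ⟶ Y}
    {q' : X'.G ⟶ Y} (hq : X.γ = yo.map q) (hq' : X'.γ = yo.map q') :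
    Set.range q.v = Set.range q'.v := by
  obtain ⟨e, -, h2⟩ := DGraph.cls_eq.1 h
  rw [hq, hq', ← yo.map_comp] at h2
  rw [← yo_injective h2]
  exact (Gr.v_bijective_of_isIso e.hom).2.range_comp _

end comparison

/-! ### Presentations of Kleisli morphisms by graphs etale over the target -/

section presentation

variable {R Y Z : Gr}

/-- The glued graph carries a universal cocone, so another cocone is universal precisely when the
induced comparison is invertible. -/
lemma Coc.isUniv_iff_isIso {K : ∀ v, NGraph (R.Fl v)}
    (c : Coc R (fun v => (K v).G) (fun v => (K v).port) (yo.obj Y)) :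
    c.IsUniv ↔ IsIso (unyo (glueDesc c)) := by
  have hu := glueCoc_isUniv R K
  constructor
  · intro h
    obtain ⟨e, e1, e2⟩ := Coc.uniq hu h
    have : unyo (glueDesc c) = e.hom := by
      refine yo_injective ?_
      rw [yo_unyo]
      exact Coc.ext_hom hu (fun v => (glueDesc_q c v).trans (e1 v).symm)
        (fun x => (glueDesc_d c x).trans (e2 x).symm)
    exact this ▸ e.isIso_hom
  · intro h
    refine Coc.isUniv_congr (Coc.push_isUniv hu (yo.mapIso (@asIso _ _ _ _ _ h))) ?_ ?_
    · intro v
      refine Eq.trans ?_ (glueDesc_q c v)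
      change _ ≫ yo.map (unyo (glueDesc c)) = _
      rw [yo_unyo]
      rfl
    · intro x
      refine Eq.trans ?_ (glueDesc_d c x)
      change (yo.map (unyo (glueDesc c))).app _ _ = _
      rw [yo_unyo]
      rfl

/-- A presentation of a morphism of species `R ⟶ bar Y`: the underlying map on arcs, and for each
vertex of `R` a graph etale over `Y` representing its image. -/
structure Presentation (φ : yo.obj R ⟶ bar (yo.obj Y)) where
  d : R.A → Y.A
  K : ∀ v, NGraph (R.Fl v)
  q : ∀ v, (K v).G ⟶ Y
  ev_arc : ∀ a, ev φ (R.arc a) = (⟨Y.arc (d a)⟩ : (yo.obj Y).obj (.op .unit))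
  ev_cor : ∀ v, DGraph.cls ⟨K v, yo.map (q v)⟩ = ev φ (R.corAt v)

namespace Presentation

/-- The presentation given by the chosen representatives. -/
def ofRep (φ : yo.obj R ⟶ bar (yo.obj Y)) : Presentation φ where
  d a := (show (yo.obj Y).obj (.op .unit) from ev φ (R.arc a)).down.a true
  K v := (rep φ v).toNGraph
  q v := unyo (rep φ v).γ
  ev_arc a := congrArg ULift.up (eq_arc _)
  ev_cor v := by
    rw [yo_unyo]
    exact rep_cls φ v

variable {φ : yo.obj R ⟶ bar (yo.obj Y)} (P : Presentation φ)

/-- The decorated graph representing the image of a vertex. -/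
abbrev dgraph (v : R.V) : DGraph (R.Fl v) (yo.obj Y) := ⟨P.K v, yo.map (P.q v)⟩

/-- The cocone given by a presentation. -/
abbrev coc : Coc R (fun v => (P.K v).G) (fun v => (P.K v).port) (yo.obj Y) :=
  cocOf φ P.dgraph P.ev_cor

lemma coc_d (a : R.A) : P.coc.d a = ⟨Y.arc (P.d a)⟩ := P.ev_arc a

lemma arc_injective {a b : Y.A}
    (h : (⟨Y.arc a⟩ : (yo.obj Y).obj (.op .unit)) = ⟨Y.arc b⟩) : a = b :=
  congrArg (fun t : ULift (El.unit.gr ⟶ Y) => t.down.a true) h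

lemma d_i (a : R.A) : P.d (R.i a) = Y.i (P.d a) := by
  have := P.coc.d_i a
  rw [coc_d, coc_d] at this
  exact arc_injective (this.trans (congrArg ULift.up (rev_comp_arc _ _)))

/-- The arc of a flag points out of its vertex, while the port labelled by that flag points into the
substituted graph; hence the reversal `R.i`. -/
lemma q_port (v : R.V) (h : R.Fl v) : (P.q v).a ((P.K v).port h) = P.d (R.i (R.s h.1)) := by
  have := P.coc.compat v h
  rw [coc_d] at this
  exact arc_injective ((congrArg ULift.up (arc_comp _ _).symm).trans this)

/-- The comparison morphism from the glued graph to `Y`. -/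
def glueMap : glue R P.K ⟶ Y := unyo (glueDesc P.coc)

lemma glueQ_glueMap (v : R.V) : glueQ R P.K v ≫ P.glueMap = P.q v := by
  refine yo_injective ?_
  rw [yo.map_comp, glueMap, yo_unyo]
  exact glueDesc_q P.coc v

lemma glueMap_v (w : Σ v, (P.K v).G.V) : P.glueMap.v w = (P.q w.1).v w.2 := by
  rw [← P.glueQ_glueMap]; rfl

lemma glueMap_h (w : Σ v, (P.K v).G.H) : P.glueMap.h w = (P.q w.1).h w.2 := by
  rw [← P.glueQ_glueMap]; rfl

lemma glueMap_a_inl (a : R.A) : P.glueMap.a (.inl a) = P.d a := by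
  have h := glueDesc_d P.coc a
  rw [coc_d] at h
  exact congrArg (fun t : ULift (El.unit.gr ⟶ Y) => t.down.a true) h

/-- Genericity is defined by chosen representatives. Here it can be tested on any presentation, in
particular on the one by the fibres of a compression. -/
lemma isIso_colimMap_iff : IsIso (colimMap φ) ↔ IsIso P.glueMap :=
  (_root_.isIso_colimMap_iff φ P.dgraph P.ev_cor).trans (Coc.isUniv_iff_isIso _)

/-- A presentation of a composite, at a vertex. -/
lemma comp_cor (ψ : yo.obj Y ⟶ bar (yo.obj Z)) (Q : Presentation ψ) (v : R.V) :
    ∃ (X : DGraph (R.Fl v) (yo.obj Z)) (q : X.G ⟶ Z),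
      X.cls = ev (φ ≫ barMap ψ ≫ muApp (yo.obj Z)) (R.corAt v) ∧ X.γ = yo.map q ∧
        Set.range q.v = ⋃ w, Set.range (Q.q ((P.q v).v w)).v := by
  -- The composite substitutes into `P.K v`, at each vertex `w`, the graph that `ψ` assigns to the
  -- image of `w` in `Y`. The multiplication may be computed with the representatives from `Q`,
  -- pulled back along `P.q v`.
  let D : DGraph (R.Fl v) (bar (yo.obj Z)) := (P.dgraph v).push ψ
  have hL : ∀ w, ((Q.dgraph ((P.q v).v w)).relabel (equivOf (atMap (P.q v) w))).cls =
      ev D.γ (D.G.corAt w) := fun w => rep_pull (P.q v) ψ Q.dgraph Q.ev_cor w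
  let X := subst D _ hL
  refine ⟨X, unyo X.γ, ?_, (yo_unyo _).symm, ?_⟩
  · refine (mu_subst D _ hL).symm.trans ?_
    exact congrArg (fun t => muVal (yo.obj Z) (R.elAt v) (barApp ψ (R.elAt v) t)) (P.ev_cor v)
  · have key : ∀ w : D.G.V, ∀ u : (Q.K ((P.q v).v w)).G.V,
        (unyo X.γ).v (show X.G.V from ⟨w, u⟩) = (Q.q ((P.q v).v w)).v u := by
      intro w u
      have h1 : glueQ D.G (fun w => ((Q.dgraph ((P.q v).v w)).relabel
          (equivOf (atMap (P.q v) w))).toNGraph) w ≫ unyo X.γ = Q.q ((P.q v).v w) := by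
        refine yo_injective ?_
        refine (yo.map_comp _ _).trans ((congrArg (yo.map _ ≫ ·) (yo_unyo _)).trans ?_)
        exact glueDesc_q (cocOf D.γ _ hL) w
      rw [← h1]
      rfl
    ext z
    simp only [Set.mem_iUnion, Set.mem_range]
    constructor
    · rintro ⟨⟨w, u⟩, rfl⟩
      exact ⟨w, u, (key w u).symm⟩
    · rintro ⟨w, u, rfl⟩
      exact ⟨⟨w, u⟩, key w u⟩

end Presentation

/-- The assigned graphs are the corollas of `R`, whose colimit is `R`, and `f` carries this colimit
cocone to `Y`. Needed to lift isomorphisms of graphs to the wide subcategory of generic morphisms.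
-/
lemma isIso_colimMap_iso (f : R ≅ Y) : IsIso (colimMap (yo.map f.hom ≫ etaApp (yo.obj Y))) := by
  let y : ∀ v, (yo.obj Y).obj (.op (R.elAt v)) := fun v => ULift.up (R.corAt v ≫ f.hom)
  rw [isIso_colimMap_iff _ (fun v => etaFun (R.finite_fl v) (y v)) (fun v => rfl)]
  exact Coc.isUniv_congr (Coc.push_isUniv (corCoc_isUniv R y) (yo.mapIso f)) (fun v => rfl)
    (fun x => rfl)

end presentation

namespace Presentation

variable {R Y : Gr} {φ : yo.obj R ⟶ bar (yo.obj Y)} (P : Presentation φ)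

/-- For generic `φ` the vertices of `Y` are the disjoint union of those of the assigned graphs. -/
lemma q_v_injective (hφ : IsIso (colimMap φ)) (v : R.V) : Function.Injective (P.q v).v := by
  have := P.isIso_colimMap_iff.1 hφ
  intro x y hxy
  have h : P.glueMap.v (⟨v, x⟩ : Σ v, (P.K v).G.V) = P.glueMap.v (⟨v, y⟩ : Σ v, (P.K v).G.V) := by
    rw [glueMap_v, glueMap_v]
    exact hxy
  exact eq_of_heq (Sigma.mk.inj ((Gr.v_bijective_of_isIso P.glueMap).1 h)).2

/-- The arc of `x` is opposite to the port labelled `x`, and this port is not on an isolated edge.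
Hence Kleisli morphisms send arcs of flags to arcs of flags, which is where `h^F` comes from. -/
lemma exists_flag (x : R.H) : ∃ k : (P.K (R.p x)).G.H,
    P.d (R.s x) = Y.s (P.glueMap.h (⟨R.p x, k⟩ : Σ v, (P.K v).G.H)) := by
  obtain ⟨k, hk⟩ := (P.K (R.p x)).exists_i_port ⟨x, rfl⟩
  refine ⟨k, ?_⟩
  rw [glueMap_h, ← (P.q _).a_s, hk, (P.q _).a_i, P.q_port, P.d_i, Y.i_i]

end Presentation

/-- An arc lies on the edge of some flag, and a flag sits at a vertex. This yields surjectivity of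
`h_V` for the compression built from a generic morphism. -/
lemma Gr.Effective.nonempty_v {X : Gr} (hX : X.Effective) : Nonempty X.V := by
  obtain ⟨⟨⟨a⟩⟩ | h, h2⟩ := hX
  · obtain ⟨x, -⟩ | ⟨x, -⟩ := h2.eq_s_or a <;> exact ⟨X.p x⟩
  · exact h

/-! ### Compressions, their fibres and the opposite Kleisli morphisms -/

namespace BMGraph

variable {σ ρ : BMGraph}

lemma arcInv_inl_eq_inl {τ : BMGraph} {f g : τ.F} (h : τ.arcInv (.inl f) = .inl g) :
    τ.j f = g := by
  by_cases hf : τ.j f = f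
  · simp [arcInv, hf] at h
  · simpa [arcInv, hf] using h

lemma arcInv_inl_of_tail {τ : BMGraph} {f : τ.F} (h : τ.j f = f) :
    τ.arcInv (.inl f) = .inr ⟨f, h⟩ := by
  simp [arcInv, h]

lemma arcInv_inl_of_not {τ : BMGraph} {f : τ.F} (h : τ.j f ≠ f) :
    τ.arcInv (.inl f) = .inl (τ.j f) := by
  simp [arcInv, h]

lemma isPort_inr {τ : BMGraph} (t : τ.tails) : τ.toGr.IsPort (.inr t) := by
  rintro ⟨k, hk⟩
  cases hk

lemma not_isPort_inl {τ : BMGraph} (f : τ.F) : ¬ τ.toGr.IsPort (.inl f) := fun h => h ⟨f, rfl⟩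

lemma Hom.bd_jh_all (h : Hom σ ρ) (f : σ.F) : h.hV (σ.bd (h.jh f)) = h.hV (σ.bd f) := by
  by_cases hf : f ∈ Set.range h.hF
  · rw [(h.jh_fix f).2 hf]
  · exact h.bd_jh f hf

/-- The field `edge` settles the flags whose image lies on an edge of `σ`. If the image is a tail,
surjectivity on tails shows that the flag itself is a tail, so no edge of `ρ` is cut in `σ`. -/
lemma compression_j_hF {h : σ ⟶ ρ} (hc : compression h) (f : ρ.F) :
    σ.j (Hom.hF h f) = Hom.hF h (ρ.j f) := by
  by_cases hf : σ.j (Hom.hF h f) = Hom.hF h f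
  · obtain ⟨t, ht, e⟩ := hc.surjOn hf
    obtain rfl := Hom.hF_inj h e
    rw [hf, show ρ.j t = t from ht]
  · exact (Hom.edge h f hf).symm

/-- All tails of `σ` lie in the image of `h^F`, so there are no virtual contractions of pairs of
tails. -/
lemma compression_jh {h : σ ⟶ ρ} (hc : compression h) {f : σ.F}
    (hf : f ∉ Set.range (Hom.hF h)) : Hom.jh h f = σ.j f := by
  refine Hom.jh_edge h f hf fun hj => hf ?_
  obtain ⟨t, -, e⟩ := hc.surjOn hj
  exact ⟨t, e⟩

lemma compression_ext {h h' : σ ⟶ ρ} (hc : compression h) (hc' : compression h')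
    (hF : ∀ f, Hom.hF h f = Hom.hF h' f) (hV : ∀ w, Hom.hV h w = Hom.hV h' w) : h = h' := by
  have e : Hom.hF h = Hom.hF h' := funext hF
  refine Hom.ext e (funext hV) (funext fun f => ?_)
  by_cases hf : f ∈ Set.range (Hom.hF h)
  · rw [(Hom.jh_fix h f).2 hf, (Hom.jh_fix h' f).2 (e ▸ hf)]
  · rw [compression_jh hc hf, compression_jh hc' (e ▸ hf)]

section fibre

variable (h : Hom σ ρ)

/-- The graph with vertices `h_V⁻¹(x)` whose edges are the contracted edges over `x`, and whose
tails are the images of the flags at `x`. -/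
def fibre (x : ρ.V) : BMGraph where
  V := {w : σ.V // h.hV w = x}
  F := {f : σ.F // h.hV (σ.bd f) = x}
  finV := by
    have := σ.finV
    infer_instance
  finF := by
    have := σ.finF
    infer_instance
  bd f := ⟨σ.bd f.1, f.2⟩
  j f := ⟨h.jh f.1, (h.bd_jh_all f.1).trans f.2⟩
  j_j f := Subtype.ext (h.jh_jh f.1)

lemma fibre_j_eq_iff (x : ρ.V) (f : (fibre h x).F) :
    (fibre h x).j f = f ↔ f.1 ∈ Set.range h.hF := by
  rw [← h.jh_fix]
  exact Subtype.ext_iff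

/-- The fibre over `x` as a graph whose set of ports is the set of flags at `x`. -/
def fibreN (x : ρ.V) : NGraph (ρ.toGr.Fl x) where
  G := (fibre h x).toGr
  eff := by
    obtain ⟨w, hw⟩ := h.hV_surj x
    exact ⟨.inr ⟨⟨w, hw⟩⟩, toGr_noIsolatedEdges _⟩
  β := Equiv.ofBijective
    (fun f => ⟨.inr ⟨⟨h.hF f.1, (h.bd_hF f.1).trans f.2⟩, (fibre_j_eq_iff h x _).2 ⟨f.1, rfl⟩⟩,
      isPort_inr _⟩) <| by
    constructor
    · intro f g e
      have e1 := Sum.inr.inj (congrArg Subtype.val e)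
      exact Subtype.ext (h.hF_inj (congrArg (fun t => t.1.1) e1))
    · rintro ⟨f | ⟨f, hf⟩, hp⟩
      · exact (not_isPort_inl f hp).elim
      · obtain ⟨g, hg⟩ := (fibre_j_eq_iff h x f).1 hf
        refine ⟨⟨g, ?_⟩, Subtype.ext (congrArg Sum.inr (Subtype.ext (Subtype.ext hg)))⟩
        change ρ.bd g = x
        rw [← h.bd_hF, hg, f.2]

end fibre

variable {h : σ ⟶ ρ}

/-- The etale morphism from the fibre over a vertex. -/
def fibreMap (hc : compression h) (x : ρ.V) : (fibre h x).toGr ⟶ σ.toGr where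
  -- The copy of a tail of the fibre points into the fibre, so it goes to the reverse in `σ` of the
  -- arc of that tail: the other flag of a cut edge, or the copy of a tail of `σ`.
  a := Sum.elim (fun f => .inl f.1) (fun t => σ.arcInv (.inl t.1.1))
  h f := f.1
  v w := w.1
  a_i := by
    rintro (f | t)
    · by_cases hf : (fibre h x).j f = f
      · change Sum.elim _ _ ((fibre h x).arcInv (.inl f)) = _
        rw [arcInv_inl_of_tail hf]
        rfl
      · change Sum.elim _ _ ((fibre h x).arcInv (.inl f)) = σ.arcInv (.inl f.1)
        have h1 : Hom.jh h f.1 = σ.j f.1 :=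
          compression_jh hc fun hr => hf ((fibre_j_eq_iff h x f).2 hr)
        have h2 : σ.j f.1 ≠ f.1 := fun e => hf (Subtype.ext (h1.trans e))
        rw [arcInv_inl_of_not hf, arcInv_inl_of_not h2, ← h1]
        rfl
    · exact (σ.toGr.i_i (.inl t.1.1)).symm
  a_s _ := rfl
  v_p _ := rfl
  cart w k hk := by
    refine ⟨⟨k, ?_⟩, ⟨Subtype.ext hk, rfl⟩, fun y hy => Subtype.ext hy.2⟩
    exact (congrArg (Hom.hV h) hk).trans w.2

/-- The map on arcs induced by a compression. -/
def arcMap (hc : compression h) : ρ.toGr.A → σ.toGr.A :=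
  Sum.elim (fun f => .inl (Hom.hF h f)) (fun t => .inr ⟨Hom.hF h t.1, hc.mapsTo t.2⟩)

lemma arcMap_i (hc : compression h) (a : ρ.toGr.A) :
    arcMap hc (ρ.toGr.i a) = σ.toGr.i (arcMap hc a) := by
  obtain f | t := a
  · change arcMap hc (ρ.arcInv (.inl f)) = σ.arcInv (.inl (Hom.hF h f))
    have hj := compression_j_hF hc f
    by_cases hf : ρ.j f = f
    · rw [hf] at hj
      rw [arcInv_inl_of_tail hf, arcInv_inl_of_tail hj]
      rfl
    · have hf' : σ.j (Hom.hF h f) ≠ Hom.hF h f := fun e => hf (Hom.hF_inj h (hj.symm.trans e))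
      rw [arcInv_inl_of_not hf, arcInv_inl_of_not hf', hj]
      rfl
  · rfl

/-- The cocone of the fibres of a compression. -/
def fibreCoc (hc : compression h) : Coc ρ.toGr (fun x => (fibreN h x).G)
    (fun x => (fibreN h x).port) (yo.obj σ.toGr) where
  γ x := yo.map (fibreMap hc x)
  d a := ⟨σ.toGr.arc (arcMap hc a)⟩
  d_i a := congrArg ULift.up
    ((congrArg σ.toGr.arc (arcMap_i hc a)).trans (rev_comp_arc _ _).symm)
  compat _ f := congrArg ULift.up ((arc_comp _ _).trans
    (congrArg σ.toGr.arc (arcMap_i hc (.inl f.1)).symm))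

/-- The Kleisli morphism opposite to a compression. -/
def oppHom (hc : compression h) : ρ.toKl ⟶ σ.toKl :=
  InducedCategory.homMk (Kleisli.Hom.mk (_root_.toBar (fibreN h) (fibreCoc hc)))

/-- The presentation of the Kleisli morphism opposite to a compression by its fibres. -/
def fibrePresentation (hc : compression h) : Presentation (KlGr.toBar (oppHom hc)) where
  d := arcMap hc
  K := fibreN h
  q := fibreMap hc
  ev_arc _ := rfl
  ev_cor v := (toBar_cor (fibreN h) (fibreCoc hc) v).symm

/-- The fibres partition the vertices of `σ`. The ports of the glued graph are the copies of the
tails of `ρ`, and a compression sends tails to tails, so `isIso_of_ports` applies. -/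
lemma oppHom_generic (hc : compression h) : generic (oppHom hc) := by
  let P := fibrePresentation hc
  refine P.isIso_colimMap_iff.2 (isIso_of_ports (glue_noIsolatedEdges _ _ ρ.toGr_noIsolatedEdges)
    σ.toGr_noIsolatedEdges _ ⟨?_, fun w => ?_⟩ ?_)
  · rintro ⟨x, w, hw⟩ ⟨x', w', hw'⟩ e
    have e' : w = w' := (P.glueMap_v ⟨x, w, hw⟩).symm.trans (e.trans (P.glueMap_v ⟨x', w', hw'⟩))
    subst e'
    have e'' : x = x' := hw.symm.trans hw'
    subst e''
    rfl
  · exact ⟨⟨Hom.hV h w, w, rfl⟩, P.glueMap_v _⟩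
  · rintro (a | a) ha
    · obtain f | t := a
      · exact (not_isPort_inl f ((glue_isPort_inl _ _ _).1 ha)).elim
      · exact (P.glueMap_a_inl (.inr t)) ▸ isPort_inr _
    · exact (glue_isPort_inr _ _ _ ha).elim

end BMGraph

open BMGraph

/-! ### Uniqueness and composition of opposites -/

section opposite

variable {σ ρ : BMGraph} {h : σ ⟶ ρ} {φ : ρ.toKl ⟶ σ.toKl}

/-- `IsOpposite` quantifies over all representatives at a vertex, but by `DGraph.range_v_eq` they
all have the same image, so one suffices. -/
lemma isOpposite_of_representatives
    (ha : ∀ f : ρ.F, ev (KlGr.toBar φ) (ρ.toGr.arc (.inl f)) =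
      (⟨σ.toGr.arc (.inl (BMGraph.Hom.hF h f))⟩ : (yo.obj σ.toGr).obj (.op .unit)))
    (hv : ∀ x : ρ.V, ∃ (X : DGraph (ρ.toGr.Fl x) (yo.obj σ.toGr)) (q : X.G ⟶ σ.toGr),
      X.cls = ev (KlGr.toBar φ) (ρ.toGr.corAt x) ∧ X.γ = yo.map q ∧
        Set.range q.v = BMGraph.Hom.hV h ⁻¹' {x}) : IsOpposite h φ := by
  refine ⟨ha, fun x X q hX hq => ?_⟩
  obtain ⟨X', q', hX', hq', hr⟩ := hv x
  rw [← hr]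
  exact DGraph.range_v_eq (hX.trans hX'.symm) hq hq'

lemma IsOpposite.d_inl (ho : IsOpposite h φ) (P : Presentation (KlGr.toBar φ)) (f : ρ.F) :
    P.d (.inl f) = .inl (BMGraph.Hom.hF h f) :=
  Presentation.arc_injective ((P.ev_arc _).symm.trans (ho.1 f))

lemma IsOpposite.range_q (ho : IsOpposite h φ) (P : Presentation (KlGr.toBar φ)) (x : ρ.V) :
    Set.range (P.q x).v = BMGraph.Hom.hV h ⁻¹' {x} :=
  ho.2 x (P.dgraph x) (P.q x) (P.ev_cor x) rfl

lemma isOpposite_oppHom (hc : compression h) : IsOpposite h (oppHom hc) := by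
  let P := fibrePresentation hc
  refine isOpposite_of_representatives (fun f => P.ev_arc _)
    fun x => ⟨P.dgraph x, P.q x, P.ev_cor x, rfl, ?_⟩
  exact Subtype.range_coe_subtype

/-- The map on arcs is given by `h^F` on flags, and by the involution on the copies of tails.
Genericity embeds the vertices of each assigned graph in `σ`; since its image is `h_V⁻¹(x)` and its
ports are fixed by the map on arcs, `DGraph.rel_of_range_eq` identifies the isomorphism classes. -/
lemma IsOpposite.unique {φ' : ρ.toKl ⟶ σ.toKl} (ho : IsOpposite h φ) (ho' : IsOpposite h φ')
    (hφ : generic φ) (hφ' : generic φ') : φ = φ' := by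
  let P := Presentation.ofRep (KlGr.toBar φ)
  let P' := Presentation.ofRep (KlGr.toBar φ')
  have hd : ∀ a, P.d a = P'.d a := by
    have h1 : ∀ f, P.d (.inl f) = P'.d (.inl f) := fun f => by
      rw [ho.d_inl P, ho'.d_inl P']
    rintro (f | t)
    · exact h1 f
    · have ht : ρ.toGr.i (.inl t.1) = .inr t := arcInv_inl_of_tail t.2
      rw [← ht]
      exact (P.d_i _).trans ((congrArg σ.toGr.i (h1 _)).trans (P'.d_i _).symm)
  have : KlGr.toBar φ = KlGr.toBar φ' := by
    refine dec_ext (fun a => ?_) (fun x => ?_)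
    · rw [P.ev_arc, P'.ev_arc, hd]
    · refine (P.ev_cor x).symm.trans (Eq.trans (DGraph.cls_eq.2 ?_) (P'.ev_cor x))
      refine DGraph.rel_of_range_eq _ _ (P.q_v_injective hφ x) (P'.q_v_injective hφ' x)
        ((ho.range_q P x).trans (ho'.range_q P' x).symm) fun f => ?_
      rw [P.q_port, P'.q_port, hd]
  exact InducedCategory.hom_ext (Kleisli.hom_ext this)

/-- By genericity every vertex of `σ` lies in the graph assigned to some `x`, and then both `h_V`
and `h'_V` take the value `x` there. The involution of a compression carries no further information.
-/
lemma IsOpposite.unique_left {h' : σ ⟶ ρ} (ho : IsOpposite h φ) (ho' : IsOpposite h' φ)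
    (hc : compression h) (hc' : compression h') (hφ : generic φ) : h = h' := by
  let P := Presentation.ofRep (KlGr.toBar φ)
  have := P.isIso_colimMap_iff.1 hφ
  refine compression_ext hc hc' (fun f => ?_) (fun w => ?_)
  · exact Sum.inl.inj ((ho.d_inl P f).symm.trans (ho'.d_inl P f))
  · obtain ⟨⟨x, u⟩, hu⟩ := (Gr.v_bijective_of_isIso P.glueMap).2 w
    rw [P.glueMap_v] at hu
    have h1 : w ∈ Set.range (P.q x).v := ⟨u, hu⟩
    have h2 := h1
    rw [ho.range_q P x] at h1
    rw [ho'.range_q P x] at h2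
    exact Eq.trans h1 (Eq.symm h2)

lemma isOpposite_id (σ : BMGraph) : IsOpposite (𝟙 σ) (𝟙 σ.toKl) := by
  refine isOpposite_of_representatives (fun f => rfl) fun x =>
    ⟨etaFun (σ.toGr.finite_fl x) ⟨σ.toGr.corAt x⟩, σ.toGr.corAt x, rfl, rfl, ?_⟩
  exact Set.range_const (ι := Unit)

/-- The graph assigned to `x` by the composite is assembled from those that `ψ` assigns to the
vertices in `h_V⁻¹(x)`, so its vertices form the `g_V`-preimage of `h_V⁻¹(x)`. -/
lemma IsOpposite.comp {τ : BMGraph} {g : τ ⟶ σ} {ψ : σ.toKl ⟶ τ.toKl} (hg : IsOpposite g ψ)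
    (hh : IsOpposite h φ) : IsOpposite (g ≫ h) (φ ≫ ψ) := by
  let P := Presentation.ofRep (KlGr.toBar φ)
  let Q := Presentation.ofRep (KlGr.toBar ψ)
  refine isOpposite_of_representatives (fun f => ?_) fun x => ?_
  · exact (congrArg (fun t => (KlGr.toBar ψ).app (.op .unit) t) (hh.1 f)).trans (hg.1 _)
  · obtain ⟨X, q, h1, h2, h3⟩ := P.comp_cor (KlGr.toBar ψ) Q x
    refine ⟨X, q, h1, h2, h3.trans ?_⟩
    ext z
    simp only [Set.mem_iUnion]
    have hr : ∀ y, y ∈ Set.range (P.q x).v ↔ BMGraph.Hom.hV h y = x := fun y => by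
      rw [hh.range_q P x]; rfl
    have hr' : ∀ y, z ∈ Set.range (Q.q y).v ↔ BMGraph.Hom.hV g z = y := fun y => by
      rw [hg.range_q Q y]; rfl
    change _ ↔ BMGraph.Hom.hV h (BMGraph.Hom.hV g z) = x
    constructor
    · rintro ⟨w, hw⟩
      rw [(hr' _).1 hw, ← hr]
      exact ⟨w, rfl⟩
    · intro hz
      obtain ⟨w, hw⟩ := (hr _).2 hz
      exact ⟨w, (hr' _).2 hw.symm⟩

end opposite

namespace BMGraph

/-! ### The compression opposite to a generic morphism -/

section converse

variable {σ ρ : BMGraph} {φ : yo.obj ρ.toGr ⟶ bar (yo.obj σ.toGr)} (P : Presentation φ)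

/-- The flag of `σ` corresponding to a flag of `ρ`. -/
def flagMap (f : ρ.F) : σ.F :=
  P.glueMap.h (⟨ρ.bd f, (P.exists_flag f).choose⟩ : Σ v, (P.K v).G.H)

lemma d_inl (f : ρ.F) : P.d (.inl f) = .inl (flagMap P f) := (P.exists_flag f).choose_spec

lemma flagMap_bd (f : ρ.F) : ∃ u, σ.bd (flagMap P f) = (P.q (ρ.bd f)).v u :=
  ⟨_, (P.glueMap.v_p _).symm.trans (P.glueMap_v _)⟩

variable [IsIso P.glueMap]

/-- The arcs of `ρ` form a summand of the arcs of the glued graph, which is isomorphic to `σ`. -/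
lemma d_injective : Function.Injective P.d := fun a b e =>
  Sum.inl.inj ((a_bijective_of_isIso P.glueMap).1
    ((P.glueMap_a_inl a).trans (e.trans (P.glueMap_a_inl b).symm)))

lemma flagMap_injective : Function.Injective (flagMap P) := fun f g e =>
  Sum.inl.inj (d_injective P ((d_inl P f).trans ((congrArg Sum.inl e).trans (d_inl P g).symm)))

lemma isPort_d {a : ρ.toGr.A} (ha : ρ.toGr.IsPort a) : σ.toGr.IsPort (P.d a) :=
  P.glueMap_a_inl a ▸ isPort_of_isIso P.glueMap ((glue_isPort_inl _ _ _).2 ha)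

/-- On edges this is compatibility of `d` with the involutions. For a tail of `ρ`, the reverse arc
is a port and remains one in `σ`, so the image flag has no partner. -/
lemma j_flagMap (f : ρ.F) : σ.j (flagMap P f) = flagMap P (ρ.j f) := by
  have h := P.d_i (.inl f)
  rw [d_inl] at h
  change P.d (ρ.arcInv (.inl f)) = σ.arcInv (.inl (flagMap P f)) at h
  by_cases hf : ρ.j f = f
  · rw [hf]
    by_contra hj
    rw [arcInv_inl_of_tail hf, arcInv_inl_of_not hj] at h
    exact not_isPort_inl _ (h ▸ isPort_d P (isPort_inr ⟨f, hf⟩))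
  · rw [arcInv_inl_of_not hf, d_inl] at h
    exact arcInv_inl_eq_inl h.symm

/-- The copy of `f` is a port of `σ`, hence comes from a port of the glued graph, and the ports of
the glued graph are those of `ρ`. -/
lemma exists_tail {f : σ.F} (hf : σ.j f = f) : ∃ t, ρ.j t = t ∧ flagMap P t = f := by
  obtain ⟨a, ha⟩ := (a_bijective_of_isIso P.glueMap).2 (.inr ⟨f, hf⟩)
  have hp : (glue ρ.toGr P.K).IsPort a := by
    rintro ⟨k, rfl⟩
    rw [P.glueMap.a_s] at ha
    cases ha
  obtain (t | t) | y := a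
  · exact (not_isPort_inl t ((glue_isPort_inl _ _ _).1 hp)).elim
  · refine ⟨t.1, t.2, ?_⟩
    have h1 : P.d (.inr t) = .inr ⟨f, hf⟩ := (P.glueMap_a_inl _).symm.trans ha
    have h2 := P.d_i (.inr t)
    rw [h1] at h2
    exact Sum.inl.inj ((d_inl P t.1).symm.trans h2)
  · exact (glue_isPort_inr _ _ _ hp).elim

/-- The vertex of `ρ` under a vertex of `σ`. -/
def vertexMap (w : σ.V) : ρ.V :=
  ((Equiv.ofBijective _ (v_bijective_of_isIso P.glueMap)).symm w :
    Σ v, (P.K v).G.V).1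

lemma vertexMap_glueMap (w : Σ v, (P.K v).G.V) : vertexMap P (P.glueMap.v w) = w.1 :=
  congrArg (fun t : Σ v, (P.K v).G.V => t.1)
    ((Equiv.ofBijective _ (v_bijective_of_isIso P.glueMap)).symm_apply_apply w)

lemma vertexMap_q (x : ρ.V) (u : (P.K x).G.V) : vertexMap P ((P.q x).v u) = x :=
  (congrArg (vertexMap P) (P.glueMap_v ⟨x, u⟩).symm).trans (vertexMap_glueMap P ⟨x, u⟩)

lemma range_q (x : ρ.V) : Set.range (P.q x).v = vertexMap P ⁻¹' {x} := by
  ext w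
  constructor
  · rintro ⟨u, rfl⟩
    exact vertexMap_q P x u
  · intro hw
    obtain ⟨⟨y, u⟩, rfl⟩ := (v_bijective_of_isIso P.glueMap).2 w
    obtain rfl : y = x := (vertexMap_glueMap P ⟨y, u⟩).symm.trans hw
    exact ⟨u, (P.glueMap_v ⟨y, u⟩).symm⟩

/-- The flag `f` lies in the graph assigned to some `v`. Its edge can leave this graph only through
a port, and the flags opposite to ports are the images of flags of `ρ`; so both ends of the edge lie
over `v`. -/
lemma vertexMap_bd_j {f : σ.F} (hf : f ∉ Set.range (flagMap P)) :
    vertexMap P (σ.bd (σ.j f)) = vertexMap P (σ.bd f) := by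
  obtain ⟨⟨v, k⟩, hk⟩ :=
    (P.glueMap.h_bijective_of_v_bijective (v_bijective_of_isIso P.glueMap)).2 f
  have hbd : ∀ l : (P.K v).G.H, vertexMap P (σ.bd ((P.q v).h l)) = v := fun l => by
    exact (congrArg (vertexMap P) ((P.q v).v_p l).symm).trans (vertexMap_q P v _)
  have hkf : (P.q v).h k = f := (P.glueMap_h ⟨v, k⟩).symm.trans hk
  have hs : (P.q v).a ((P.K v).G.s k) = .inl f := by
    rw [(P.q v).a_s, hkf]
    rfl
  -- Otherwise the reverse of `k` is the port with some label `x`, and `q_port` identifies `f` with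
  -- the image of `x`.
  have hj : ∃ l, (P.K v).G.s l = (P.K v).G.i ((P.K v).G.s k) := by
    by_contra hn
    obtain ⟨x, hx⟩ := NGraph.exists_port hn
    have h1 := P.q_port v x
    rw [hx, (P.q v).a_i, hs, P.d_i] at h1
    have h2 : (Sum.inl f : σ.toGr.A) = P.d (.inl x.1) := by
      rw [← σ.toGr.i_i (.inl f), h1, σ.toGr.i_i]
      rfl
    exact hf ⟨x.1, (Sum.inl.inj (h2.trans (d_inl P x.1))).symm⟩
  obtain ⟨l, hl⟩ := hj
  have h1 : σ.arcInv (.inl f) = .inl ((P.q v).h l) := by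
    refine Eq.symm (Eq.trans ((P.q v).a_s l).symm ?_)
    rw [hl, (P.q v).a_i, hs]
    rfl
  rw [arcInv_inl_eq_inl h1, hbd, ← hkf, hbd]

open Classical in
/-- The compression opposite to a generic morphism. -/
def compressionOf : σ ⟶ ρ where
  hF := flagMap P
  hV := vertexMap P
  jh f := if f ∈ Set.range (flagMap P) then f else σ.j f
  hF_inj := flagMap_injective P
  hV_surj x := by
    obtain ⟨u⟩ := (P.K x).eff.nonempty_v
    exact ⟨_, vertexMap_q P x u⟩
  j_mem f := ⟨_, (j_flagMap P f).symm⟩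
  jh_jh f := by
    by_cases hf : f ∈ Set.range (flagMap P)
    · simp only [if_pos hf]
    · have hj : σ.j f ∉ Set.range (flagMap P) := by
        rintro ⟨y, hy⟩
        exact hf ⟨ρ.j y, by rw [← j_flagMap, hy, σ.j_j]⟩
      simp only [if_neg hf, if_neg hj, σ.j_j]
  jh_fix f := by
    by_cases hf : f ∈ Set.range (flagMap P)
    · simp [hf]
    · refine ⟨fun hj => ?_, fun hr => (hf hr).elim⟩
      rw [if_neg hf] at hj
      -- A fixpoint of `σ.j` is a tail, and all tails are in the image, so `σ.j` has no fixpoint on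
      -- the complement.
      obtain ⟨t, -, ht⟩ := exists_tail P hj
      exact ⟨t, ht⟩
  jh_edge f hf _ := if_neg hf
  bd_hF f := by
    obtain ⟨u, hu⟩ := flagMap_bd P f
    rw [hu, vertexMap_q]
  bd_jh f hf := by
    rw [if_neg hf]
    exact vertexMap_bd_j P hf
  edge f _ := (j_flagMap P f).symm

lemma compressionOf_compression : compression (compressionOf P) := by
  refine ⟨fun t ht => ?_, (flagMap_injective P).injOn, fun f hf => ?_⟩
  · exact (j_flagMap P t).trans (congrArg _ ht)
  · exact exists_tail P hf

end converse

/-! ### The functor from compressions to generic morphisms -/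

lemma exists_compression {σ ρ : BMGraph} {φ : ρ.toKl ⟶ σ.toKl} (hφ : generic φ) :
    ∃ h : σ ⟶ ρ, compression h ∧ IsOpposite h φ := by
  let P : Presentation (R := ρ.toGr) (Y := σ.toGr) (KlGr.toBar φ) := Presentation.ofRep _
  have := P.isIso_colimMap_iff.1 hφ
  refine ⟨compressionOf P, compressionOf_compression P, isOpposite_of_representatives
    (fun f => ?_) fun x => ⟨P.dgraph x, P.q x, P.ev_cor x, rfl, range_q P x⟩⟩
  exact (P.ev_arc _).trans (congrArg (fun a => ULift.up (σ.toGr.arc a)) (d_inl P f))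

/-- The functor sending a compression to the opposite generic morphism. -/
def toGeneric : WideSubcategory compression ⥤ (WideSubcategory generic)ᵒᵖ where
  obj σ := .op ⟨σ.obj.toKl⟩
  map h := Quiver.Hom.op ⟨oppHom h.property, oppHom_generic h.property⟩
  -- Both functor laws follow from uniqueness of the generic opposite of a given compression,
  -- without comparing the fibres of a composite with iterated gluings.
  map_id σ := congrArg Quiver.Hom.op <| WideSubcategory.hom_ext _ <|
    (isOpposite_oppHom (compression.id_mem σ.obj)).unique (isOpposite_id σ.obj)
      (oppHom_generic _) (generic.id_mem _)
  map_comp g h := congrArg Quiver.Hom.op <| WideSubcategory.hom_ext _ <|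
    (isOpposite_oppHom (compression.comp_mem _ _ g.property h.property)).unique
      ((isOpposite_oppHom g.property).comp (isOpposite_oppHom h.property))
      (oppHom_generic _)
      (generic.comp_mem _ _ (oppHom_generic h.property) (oppHom_generic g.property))

instance : toGeneric.Faithful where
  map_injective {σ ρ g h} e := by
    have e' : oppHom g.property = oppHom h.property :=
      congrArg (fun t => t.unop.hom) e
    refine WideSubcategory.hom_ext _ ((isOpposite_oppHom g.property).unique_left ?_
      g.property h.property (oppHom_generic g.property))
    rw [e']
    exact isOpposite_oppHom h.property

instance : toGeneric.Full where
  map_surjective {σ ρ} φ := by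
    obtain ⟨h, hc, ho⟩ := exists_compression φ.unop.property
    exact ⟨⟨h, hc⟩, congrArg Quiver.Hom.op <| WideSubcategory.hom_ext _ <|
      (isOpposite_oppHom hc).unique ho (oppHom_generic hc) φ.unop.property⟩

/-! ### Essential surjectivity -/

section surjective

variable (R : Gr)

open Classical in
/-- The involution on the flags of a graph which interchanges the flags of an inner edge. -/
def flagInv (x : R.H) : R.H := if h : ∃ y, R.s y = R.i (R.s x) then h.choose else x

lemma flagInv_eq {x y : R.H} (h : R.s y = R.i (R.s x)) : flagInv R x = y := by
  have h' : ∃ y, R.s y = R.i (R.s x) := ⟨y, h⟩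
  rw [flagInv, dif_pos h']
  exact R.s_inj (h'.choose_spec.trans h.symm)

lemma flagInv_of_isPort {x : R.H} (h : R.IsPort (R.i (R.s x))) : flagInv R x = x :=
  dif_neg h

/-- The graph of Borisov and Manin associated with a graph. -/
def ofGr : BMGraph where
  V := R.V
  F := R.H
  finV := R.finV
  finF := R.finH
  bd := R.p
  j := flagInv R
  j_j x := by
    by_cases h : R.IsPort (R.i (R.s x))
    · rw [flagInv_of_isPort R h, flagInv_of_isPort R h]
    · obtain ⟨y, hy⟩ := not_not.1 h
      rw [flagInv_eq R hy]
      exact flagInv_eq R (by rw [hy, R.i_i])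

/-- A partner `y` would satisfy `y = x`, making the arc of `x` a fixpoint of the involution `i`. -/
lemma isPort_of_flagInv_eq {x : R.H} (h : flagInv R x = x) : R.IsPort (R.i (R.s x)) := by
  rintro ⟨y, hy⟩
  rw [flagInv_eq R hy] at h
  rw [h] at hy
  exact R.i_ne _ hy.symm

/-- The comparison of a graph with the graph associated with its set of flags. -/
def ofGrMap : (ofGr R).toGr ⟶ R where
  a := Sum.elim R.s (fun t => R.i (R.s t.1))
  h := id
  v := id
  a_i := by
    rintro (x | t)
    · change Sum.elim _ _ ((ofGr R).arcInv (.inl x)) = R.i (R.s x)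
      by_cases h : (ofGr R).j x = x
      · rw [arcInv_inl_of_tail h]
        rfl
      · rw [arcInv_inl_of_not h]
        have h' : ¬ R.IsPort (R.i (R.s x)) := fun hp => h (flagInv_of_isPort R hp)
        obtain ⟨y, hy⟩ := not_not.1 h'
        rw [← hy]
        exact congrArg R.s (flagInv_eq R hy)
    · exact (R.i_i _).symm
  a_s _ := rfl
  v_p _ := rfl
  cart w k hk := ⟨k, ⟨hk, rfl⟩, fun y hy => hy.2⟩

/-- The map is the identity on vertices, and the copy of a tail goes to the reverse of an arc
without partner flag, which is a port. Isolated edges of `R` would be missed, hence `hR`. -/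
lemma isIso_ofGrMap (hR : R.NoIsolatedEdges) : IsIso (ofGrMap R) := by
  refine isIso_of_ports (toGr_noIsolatedEdges _) hR _ Function.bijective_id ?_
  rintro (x | t) h
  · exact (not_isPort_inl x h).elim
  · exact isPort_of_flagInv_eq R t.2

end surjective

/-- Isomorphic graphs are isomorphic in the restricted Kleisli category. -/
def klIso {R Y : KlGr} (f : R.1 ≅ Y.1) : R ≅ Y :=
  InducedCategory.isoMk ((Kleisli.Adjunction.toKleisli ccp).mapIso (yo.mapIso f))

lemma klIso_generic {R Y : KlGr} (f : R.1 ≅ Y.1) : generic (klIso f).hom :=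
  isIso_colimMap_iso f

/-- An isomorphism in the wide subcategory needs both directions generic; they are induced by `e`
and its inverse. -/
instance : toGeneric.EssSurj where
  mem_essImage R := by
    have := isIso_ofGrMap R.unop.obj.1 R.unop.obj.2
    let e : (ofGr R.unop.obj.1).toKl.1 ≅ R.unop.obj.1 := @asIso _ _ _ _ _ this
    exact ⟨⟨ofGr R.unop.obj.1⟩, ⟨(WideSubcategory.isoMk (X := R.unop)
      (Y := ⟨(ofGr R.unop.obj.1).toKl⟩) (klIso e.symm) (klIso_generic e.symm)
      (klIso_generic e)).op⟩⟩

instance : toGeneric.IsEquivalence where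

end BMGraph

end

theorem mainTheorem3 :
    ∃ (Φ : WideSubcategory BMGraph.compression ≌ (WideSubcategory generic)ᵒᵖ)
      (hΦ : ∀ σ : WideSubcategory BMGraph.compression,
        Φ.functor.obj σ = Opposite.op ⟨σ.obj.toKl⟩),
      ∀ (σ ρ : WideSubcategory BMGraph.compression) (h : σ ⟶ ρ),
        IsOpposite h.hom
          (eqToHom (hΦ σ).symm ≫ Φ.functor.map h ≫ eqToHom (hΦ ρ)).unop.hom := by
  refine ⟨BMGraph.toGeneric.asEquivalence, fun _ => rfl, fun σ ρ h => ?_⟩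
  -- The equality of objects holds by definition, so the transports are identities.
  have e : eqToHom rfl ≫ BMGraph.toGeneric.map h ≫ eqToHom rfl = BMGraph.toGeneric.map h := by simp
  exact (congrArg (fun t => t.unop.hom) e).symm ▸ isOpposite_oppHom h.property
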